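/- All spaces are real. For $1\le r\le\infty$ let $r'$ be the conjugate exponent, $1/r+1/r'=1$; sums $(\sum_i t_i^r)^{1/r}$ are read as $\max_i t_i$ if $r=\infty$. In a Banach lattice, for $1\le r\le\infty$, $$\Big(\sum_{i=1}^n|x_i|^r\Big)^{1/r}:=\sup\Big\{\sum_{i=1}^n a_ix_i : a\in\mathbb R^n,\ \|a\|_{\ell_{r'}^n}\le 1\Big\}$$ (supremum in the order of the lattice; it is $\bigvee_i|x_i|$ if $r=\infty$). The dual of a Banach lattice is a Banach lattice for the order $f\le g\iff f(y)\le g(y)$ for all $y\ge 0$. Let $1\le q\le p\le\infty$. A linear map $T:X\to Y$ from a Banach space $X$ to a Banach lattice $Y$ is $(p,q)$-convex if there is $C\ge 0$ such that, for all $n$ and all $x_1,\dots,x_n\in X$, $$\Big\|\Big(\sum_{i=1}^n|Tx_i|^p\Big)^{1/p}\Big\|\le C\Big(\sum_{i=1}^n\|x_i\|^q\Big)^{1/q}.$$ A linear map $T:X\to Y$ from a Banach lattice $X$ to a Banach space $Y$ is $(p,q)$-concave if there is $C\ge 0$ such that, for all $n$ and all $x_1,\dots,x_n\in X$, $$\Big(\sum_{i=1}^n\|Tx_i\|^p\Big)^{1/p}\le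 C\Big\|\Big(\sum_{i=1}^n|x_i|^q\Big)^{1/q}\Big\|.$$ Write $\mathcal{CX}_{p,q}(X,Y)$ and $\mathcal{CC}_{p,q}(X,Y)$ for the corresponding spaces of operators, normed by the least constant $C$. For $z$ in the algebraic tensor product $X\otimes Z$ put $$\delta_{p,q}(z)=\inf\Big\{\Big(\sum_i\|x_i\|^q\Big)^{1/q}\Big\|\Big(\sum_i|z_i|^{p'}\Big)^{1/p'}\Big\| : z=\sum_{i=1}^n x_i\otimes z_i\Big\}\quad(X\text{ a Banach space},\ Z\text{ a Banach lattice}),$$ $$\iota_{p,q}(z)=\inf\Big\{\Big\|\Big(\sum_i|x_i|^q\Big)^{1/q}\Big\|\Big(\sum_i\|z_i\|^{p'}\Big)^{1/p'} : z=\sum_{i=1}^n x_i\otimes z_i\Big\}\quad(X\text{ a Banach lattice},\ Z\text{ a Banach space}),$$ and let $$h_{p,q}(z)=\inf\Big\{\sum_{j=1}^m\delta_{p,q}(w_j): z=\sum_{j=1}^m w_j\Big\},\qquad k_{p,q}(z)=\inf\Big\{\sum_{j=1}^m\iota_{p,q}(w_j): z=\sum_{j=1}^m w_j\Big\}.$$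 For $\alpha\in\{h_{p,q},k_{p,q}\}$ let $(X\otimes_\alpha Y^*)^*$ be the space of $\alpha$-bounded linear functionals on $X\otimes Y^*$ with the dual norm, and let $(X\otimes_\alpha Y^*)^*\cap\mathcal L(X,Y)$ be the subspace of those $\varphi$ for which there is a bounded operator $T:X\to Y$ with $\varphi(x\otimes y^*)=\langle Tx,y^*\rangle$ for all $x\in X$, $y^*\in Y^*$. **Theorem.** Let $1\le q\le p\le\infty$. 1. If $X$ is a Banach space and $Y$ is a Banach lattice, then $\mathcal{CX}_{p,q}(X,Y)=(X\otimes_{h_{p,q}}Y^*)^*\cap\mathcal L(X,Y)$ isometrically. 2. If $X$ is a Banach lattice and $Y$ is a Banach space, then $\mathcal{CC}_{p,q}(X,Y)=(X\otimes_{k_{p,q}}Y^*)^*\cap\mathcal L(X,Y)$ isometrically. That is, in each case there is a linear bijection $T\mapsto\varphi_T$ from the space on the left onto the space on the right, with $\varphi_T(x\otimes y^*)=\langle Tx,y^*\rangle$ for all $x\in X$, $y^*\in Y^*$, such that $\|\varphi_T\|$ equals the least constant $C$ of $T$. -/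

import Mathlib

open scoped ENNReal TensorProduct

section DualLattice

variable {Y : Type*} [NormedAddCommGroup Y] [Lattice Y] [HasSolidNorm Y] [IsOrderedAddMonoid Y]
  [NormedSpace ℝ Y]

/-- The order of the dual: `f ≤ g` iff `f y ≤ g y` for all `y ≥ 0`. -/
instance StrongDual.latticePartialOrder : PartialOrder (StrongDual ℝ Y) where
  le f g := ∀ y : Y, 0 ≤ y → f y ≤ g y
  le_refl _ _ _ := le_rfl
  le_trans _ _ _ h₁ h₂ y hy := (h₁ y hy).trans (h₂ y hy)
  le_antisymm f g h₁ h₂ := by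
    ext y
    have hp := le_antisymm (h₁ _ (posPart_nonneg y)) (h₂ _ (posPart_nonneg y))
    have hn := le_antisymm (h₁ _ (negPart_nonneg y)) (h₂ _ (negPart_nonneg y))
    rw [← posPart_sub_negPart y, map_sub, map_sub, hp, hn]

instance StrongDual.isOrderedAddMonoid_lattice : IsOrderedAddMonoid (StrongDual ℝ Y) where
  add_le_add_left f g h k := fun y hy => by
    simpa using h y hy

instance StrongDual.isOrderedModule_lattice : IsOrderedModule ℝ (StrongDual ℝ Y) where
  smul_le_smul_of_nonneg_left _ hc _ _ h := fun y hy =>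
    mul_le_mul_of_nonneg_left (h y hy) hc
  smul_le_smul_of_nonneg_right _ hf _ _ h := fun y hy =>
    mul_le_mul_of_nonneg_right h (hf y hy)

/-- `sup {f z : 0 ≤ z ≤ y}`, the value at `y ≥ 0` of the positive part of `f`. -/
noncomputable def StrongDual.posPartCone (f : StrongDual ℝ Y) (y : Y) : ℝ :=
  sSup (f '' Set.Icc 0 y)

theorem StrongDual.abs_apply_le_of_mem (f : StrongDual ℝ Y) {y z : Y} (hz : z ∈ Set.Icc 0 y) :
    |f z| ≤ ‖f‖ * ‖y‖ := by
  refine (f.le_opNorm z).trans (mul_le_mul_of_nonneg_left ?_ (norm_nonneg f))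
  apply norm_le_norm_of_abs_le_abs
  rw [abs_of_nonneg hz.1]
  exact hz.2.trans (le_abs_self y)

theorem StrongDual.bddAbove_cone (f : StrongDual ℝ Y) (y : Y) :
    BddAbove (f '' Set.Icc 0 y) := by
  refine ⟨‖f‖ * ‖y‖, ?_⟩
  rintro _ ⟨z, hz, rfl⟩
  exact (le_abs_self _).trans (f.abs_apply_le_of_mem hz)

theorem StrongDual.le_posPartCone (f : StrongDual ℝ Y) {y z : Y} (h0 : 0 ≤ z) (h : z ≤ y) :
    f z ≤ f.posPartCone y :=
  le_csSup (f.bddAbove_cone y) ⟨z, ⟨h0, h⟩, rfl⟩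

set_option linter.unusedSectionVars false in
theorem StrongDual.posPartCone_le (f : StrongDual ℝ Y) {y : Y} (hy : 0 ≤ y) {c : ℝ}
    (h : ∀ z, 0 ≤ z → z ≤ y → f z ≤ c) : f.posPartCone y ≤ c := by
  refine csSup_le ⟨_, 0, ⟨le_rfl, hy⟩, rfl⟩ ?_
  rintro _ ⟨z, hz, rfl⟩
  exact h z hz.1 hz.2

theorem StrongDual.posPartCone_nonneg (f : StrongDual ℝ Y) {y : Y} (hy : 0 ≤ y) :
    0 ≤ f.posPartCone y := by
  simpa using f.le_posPartCone le_rfl hy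

theorem StrongDual.posPartCone_le_norm (f : StrongDual ℝ Y) {y : Y} (hy : 0 ≤ y) :
    f.posPartCone y ≤ ‖f‖ * ‖y‖ :=
  f.posPartCone_le hy fun _ h0 h => (le_abs_self _).trans (f.abs_apply_le_of_mem ⟨h0, h⟩)

theorem StrongDual.posPartCone_add (f : StrongDual ℝ Y) {y₁ y₂ : Y} (h₁ : 0 ≤ y₁) (h₂ : 0 ≤ y₂) :
    f.posPartCone (y₁ + y₂) = f.posPartCone y₁ + f.posPartCone y₂ := by
  apply le_antisymm
  · refine f.posPartCone_le (add_nonneg h₁ h₂) fun z h0 hz => ?_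
    have hz1 : f (z ⊓ y₁) ≤ f.posPartCone y₁ := f.le_posPartCone (le_inf h0 h₁) inf_le_right
    have hz2 : f (z - z ⊓ y₁) ≤ f.posPartCone y₂ := by
      refine f.le_posPartCone (sub_nonneg.2 inf_le_left) ?_
      rw [sub_le_iff_le_add, ← sub_le_iff_le_add']
      refine le_inf (by simpa using h₂) ?_
      rwa [sub_le_iff_le_add]
    have : f z = f (z ⊓ y₁) + f (z - z ⊓ y₁) := by rw [← map_add]; simp
    linarith
  · rw [← le_sub_iff_add_le]
    refine f.posPartCone_le h₁ fun z h0 hz => ?_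
    rw [le_sub_comm]
    refine f.posPartCone_le h₂ fun w h0' hw => ?_
    rw [le_sub_iff_add_le, ← map_add]
    exact f.le_posPartCone (add_nonneg h0' h0) (by rw [add_comm y₁]; exact add_le_add hw hz)

/-- The positive part `f ⊔ 0` of a functional. -/
noncomputable def StrongDual.latticePos (f : StrongDual ℝ Y) : StrongDual ℝ Y :=
  let g : Y →+ ℝ :=
    { toFun := fun y => f.posPartCone y⁺ - f.posPartCone y⁻
      map_zero' := by simp
      map_add' := fun x y => by
        have h : (x + y)⁺ + (x⁻ + y⁻) = (x + y)⁻ + (x⁺ + y⁺) := by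
          have h1 := posPart_sub_negPart (x + y)
          have h2 := posPart_sub_negPart x
          have h3 := posPart_sub_negPart y
          have h4 : (x + y)⁺ = (x + y)⁻ + (x + y) := by
            nth_rewrite 3 [← h1]; abel
          rw [h4]
          nth_rewrite 2 [← h2]
          nth_rewrite 2 [← h3]
          abel
        have h' := congrArg f.posPartCone h
        rw [f.posPartCone_add (posPart_nonneg _)
            (add_nonneg (negPart_nonneg _) (negPart_nonneg _)),
          f.posPartCone_add (negPart_nonneg _) (negPart_nonneg _),
          f.posPartCone_add (negPart_nonneg _)
            (add_nonneg (posPart_nonneg _) (posPart_nonneg _)),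
          f.posPartCone_add (posPart_nonneg _) (posPart_nonneg _)] at h'
        linarith }
  g.toRealLinearMap (AddMonoidHomClass.continuous_of_bound g ‖f‖ fun y => by
    have hp : ‖y⁺‖ ≤ ‖y‖ := norm_le_norm_of_abs_le_abs (by
      rw [abs_of_nonneg (posPart_nonneg y)]; exact sup_le (le_abs_self y) (abs_nonneg y))
    have hn : ‖y⁻‖ ≤ ‖y‖ := norm_le_norm_of_abs_le_abs (by
      rw [abs_of_nonneg (negPart_nonneg y)]; exact sup_le (neg_le_abs y) (abs_nonneg y))
    have h1 := f.posPartCone_le_norm (posPart_nonneg y)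
    have h2 := f.posPartCone_le_norm (negPart_nonneg y)
    have h3 := f.posPartCone_nonneg (posPart_nonneg y)
    have h4 := f.posPartCone_nonneg (negPart_nonneg y)
    have h5 := mul_le_mul_of_nonneg_left hp (norm_nonneg f)
    have h6 := mul_le_mul_of_nonneg_left hn (norm_nonneg f)
    change |f.posPartCone y⁺ - f.posPartCone y⁻| ≤ _
    rw [abs_le]
    constructor <;> linarith)

theorem StrongDual.latticePos_apply (f : StrongDual ℝ Y) {y : Y} (hy : 0 ≤ y) :
    f.latticePos y = f.posPartCone y := by
  change f.posPartCone y⁺ - f.posPartCone y⁻ = _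
  rw [posPart_of_nonneg hy, negPart_of_nonneg hy, sub_eq_self]
  exact le_antisymm (by simpa using f.posPartCone_le_norm (le_refl (0 : Y)))
    (f.posPartCone_nonneg le_rfl)

/-- The dual of a normed lattice is a lattice. -/
noncomputable instance StrongDual.instLattice : Lattice (StrongDual ℝ Y) where
  sup f g := (f - g).latticePos + g
  le_sup_left f g y hy := by
    have := (f - g).le_posPartCone hy le_rfl
    simp only [add_apply, latticePos_apply _ hy, sub_apply] at this ⊢
    linarith
  le_sup_right f g y hy := by
    have := (f - g).posPartCone_nonneg hy
    simp only [add_apply, latticePos_apply _ hy] at this ⊢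
    linarith
  sup_le f g k h₁ h₂ y hy := by
    have : (f - g).posPartCone y ≤ k y - g y := by
      refine posPartCone_le _ hy fun z h0 hz => ?_
      have e1 := h₁ z h0
      have e2 := h₂ (y - z) (sub_nonneg.2 hz)
      simp only [map_sub, sub_apply] at e2 ⊢
      linarith
    simp only [add_apply, latticePos_apply _ hy]
    linarith
  inf f g := f - (f - g).latticePos
  inf_le_left f g y hy := by
    have := (f - g).posPartCone_nonneg hy
    simp only [sub_apply, latticePos_apply _ hy] at this ⊢
    linarith
  inf_le_right f g y hy := by
    have := (f - g).le_posPartCone hy le_rfl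
    simp only [sub_apply, latticePos_apply _ hy] at this ⊢
    linarith
  le_inf k f g h₁ h₂ y hy := by
    have : (f - g).posPartCone y ≤ f y - k y := by
      refine posPartCone_le _ hy fun z h0 hz => ?_
      have e1 := h₂ z h0
      have e2 := h₁ (y - z) (sub_nonneg.2 hz)
      simp only [map_sub, sub_apply] at e2 ⊢
      linarith
    simp only [sub_apply, latticePos_apply _ hy]
    linarith

theorem StrongDual.abs_apply_le_abs (f : StrongDual ℝ Y) (y : Y) : |f y| ≤ |f| |y| := by
  have h1 : f ≤ |f| := le_abs_self f
  have h2 : -f ≤ |f| := neg_le_abs f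
  have a1 := h1 _ (posPart_nonneg y)
  have a2 := h1 _ (negPart_nonneg y)
  have b1 := h2 _ (posPart_nonneg y)
  have b2 := h2 _ (negPart_nonneg y)
  simp only [neg_apply] at b1 b2
  have e1 : f y = f y⁺ - f y⁻ := by rw [← map_sub, posPart_sub_negPart]
  have e2 : |f| |y| = |f| y⁺ + |f| y⁻ := by rw [← map_add, posPart_add_negPart]
  rw [e1, e2, abs_le]
  constructor <;> linarith

theorem StrongDual.abs_apply_le_norm (f : StrongDual ℝ Y) {y : Y} (hy : 0 ≤ y) :
    |f| y ≤ ‖f‖ * ‖y‖ := by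
  have h : |f| = (f - -f).latticePos + -f := rfl
  rw [h, add_apply, latticePos_apply _ hy, neg_apply, ← sub_eq_add_neg, sub_le_iff_le_add]
  refine posPartCone_le _ hy fun z h0 hz => ?_
  have hb : |y - (z + z)| ≤ |y| := by
    rw [abs_of_nonneg hy, abs_le']
    refine ⟨sub_le_self _ (add_nonneg h0 h0), ?_⟩
    rw [neg_sub, sub_le_iff_le_add]
    exact add_le_add hz hz
  have := (neg_le_abs _).trans ((f.le_opNorm (y - (z + z))).trans
    (mul_le_mul_of_nonneg_left (norm_le_norm_of_abs_le_abs hb) (norm_nonneg f)))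
  simp only [map_sub, map_add, sub_apply, neg_apply] at this ⊢
  linarith

instance StrongDual.instHasSolidNorm : HasSolidNorm (StrongDual ℝ Y) where
  solid f g h := by
    refine f.opNorm_le_bound (norm_nonneg g) fun y => ?_
    have := (f.abs_apply_le_abs y).trans
      ((h _ (abs_nonneg y)).trans (g.abs_apply_le_norm (abs_nonneg y)))
    rwa [norm_abs_eq_norm] at this

end DualLattice

section LpSum

variable {Y : Type*} [NormedAddCommGroup Y] [Lattice Y] [HasSolidNorm Y] [IsOrderedAddMonoid Y]
  [NormedSpace ℝ Y] [IsOrderedModule ℝ Y]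

instance ENNReal.fact_one_le_conjExponent (p : ℝ≥0∞) : Fact (1 ≤ p.conjExponent) :=
  ⟨le_self_add⟩

/-- The set of all `∑ i, a i • x i` with `a` in the closed unit ball of `ℓ_{p'}^n`,
where `1 / p + 1 / p' = 1`. -/
def lpSumSet (p : ℝ≥0∞) {n : ℕ} (x : Fin n → Y) : Set Y :=
  {u | ∃ a : PiLp p.conjExponent (fun _ : Fin n => ℝ), ‖a‖ ≤ 1 ∧ u = ∑ i, a i • x i}

theorem exists_isLUB_lpSumSet [CompleteSpace Y] (p : ℝ≥0∞) {n : ℕ} (x : Fin n → Y) :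
    ∃ u, IsLUB (lpSumSet p x) u := by
  let B : Set (PiLp p.conjExponent (fun _ : Fin n => ℝ)) := Metric.closedBall 0 1
  have hB : IsCompact B := isCompact_closedBall 0 1
  have : Nonempty B := ⟨⟨0, by simp [B]⟩⟩
  let d : ℕ → B := TopologicalSpace.denseSeq B
  let F : PiLp p.conjExponent (fun _ : Fin n => ℝ) → Y := fun a => ∑ i, a i • x i
  let w : Y := ∑ i, |x i|
  have hFle : ∀ a b : PiLp p.conjExponent (fun _ : Fin n => ℝ), F a ≤ F b + dist a b • w := by
    intro a b
    rw [← sub_le_iff_le_add']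
    simp only [F, w, Finset.smul_sum, ← Finset.sum_sub_distrib, ← sub_smul]
    refine Finset.sum_le_sum fun i _ => ?_
    have hi : |a i - b i| ≤ dist a b := by
      rw [dist_eq_norm, ← Real.norm_eq_abs]
      exact PiLp.norm_apply_le (a - b) i
    have h1 : (a i - b i) • x i ≤ |a i - b i| • |x i| := by
      rcases le_total 0 (a i - b i) with h | h
      · rw [abs_of_nonneg h]
        exact smul_le_smul_of_nonneg_left (le_abs_self _) h
      · rw [abs_of_nonpos h]
        have := smul_le_smul_of_nonneg_left (neg_le_abs (x i)) (neg_nonneg.2 h)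
        rwa [neg_smul_neg] at this
    exact h1.trans (smul_le_smul_of_nonneg_right hi (abs_nonneg _))
  have hw : 0 ≤ w := Finset.sum_nonneg fun i _ => abs_nonneg _
  let v : ℕ → Y := partialSups fun k => F (d k)
  have hv : Monotone v := (partialSups fun k => F (d k)).monotone
  have hkey : ∀ ε : ℝ, 0 < ε → ∃ K : ℕ, ∀ m, v m ≤ v K + ε • w := by
    intro ε hε
    obtain ⟨t, htB, htf, ht⟩ := hB.finite_cover_balls (half_pos hε)
    have hd : ∀ c : PiLp p.conjExponent (fun _ : Fin n => ℝ), ∃ k : ℕ, c ∈ B → dist c (d k) < ε / 2 := by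
      intro c
      by_cases hc : c ∈ B
      · obtain ⟨k, hk⟩ := (TopologicalSpace.denseRange_denseSeq B).exists_dist_lt
          (⟨c, hc⟩ : B) (half_pos hε)
        exact ⟨k, fun _ => hk⟩
      · exact ⟨0, fun h => absurd h hc⟩
    choose k hk using hd
    refine ⟨htf.toFinset.sup k, fun m => ?_⟩
    refine partialSups_le _ _ _ fun j _ => ?_
    obtain ⟨c, hct, hc⟩ := Set.mem_iUnion₂.1 (ht (d j).2)
    have h1 : dist (d j : PiLp p.conjExponent (fun _ : Fin n => ℝ)) (d (k c)) ≤ ε := by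
      have := dist_triangle (d j : PiLp p.conjExponent (fun _ : Fin n => ℝ)) c (d (k c))
      have h2 := hk c (htB hct)
      rw [Metric.mem_ball] at hc
      linarith
    refine (hFle _ (d (k c))).trans (add_le_add ?_ (smul_le_smul_of_nonneg_right h1 hw))
    exact le_partialSups_of_le (fun k => F (d k)) (Finset.le_sup (htf.mem_toFinset.2 hct))
  have hc : CauchySeq v := by
    rw [Metric.cauchySeq_iff']
    intro ε hε
    obtain ⟨K, hK⟩ := hkey (ε / (‖w‖ + 1)) (by positivity)
    refine ⟨K, fun m hm => ?_⟩
    have h1 : ‖v m - v K‖ ≤ ‖(ε / (‖w‖ + 1)) • w‖ := by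
      apply norm_le_norm_of_abs_le_abs
      rw [abs_of_nonneg (sub_nonneg.2 (hv hm)), abs_of_nonneg (smul_nonneg (by positivity) hw)]
      exact sub_le_iff_le_add'.2 (hK m)
    rw [dist_eq_norm]
    refine h1.trans_lt ?_
    rw [norm_smul, Real.norm_of_nonneg (by positivity), div_mul_eq_mul_div,
      div_lt_iff₀ (by positivity)]
    nlinarith [norm_nonneg w]
  obtain ⟨u, hu⟩ := cauchySeq_tendsto_of_complete hc
  refine ⟨u, ?_, ?_⟩
  · rintro _ ⟨a, ha, rfl⟩
    have hcl : IsClosed {b : B | F b ≤ u} := by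
      have hF : Continuous fun b : B => F b := by
        refine continuous_finsetSum _ fun i _ => ?_
        fun_prop
      exact isClosed_le hF continuous_const
    have hall : ∀ b : B, F b ≤ u := fun b =>
      (TopologicalSpace.denseRange_denseSeq B).induction_on (p := fun b : B => F b ≤ u) b hcl
        fun k => (le_partialSups (fun k => F (d k)) k).trans (hv.ge_of_tendsto hu k)
    exact hall ⟨a, by simpa [B] using ha⟩
  · intro b hb
    refine le_of_tendsto' hu fun m => partialSups_le _ _ _ fun j _ => hb ⟨d j, ?_, rfl⟩
    exact mem_closedBall_zero_iff.1 (d j).2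

variable [CompleteSpace Y]

/-- The element `(∑ i, |x i| ^ p) ^ (1 / p)` of a Banach lattice for `1 ≤ p ≤ ∞`
(`⋁ i, |x i|` if `p = ∞`): the least upper bound, in the order of the lattice, of all
`∑ i, a i • x i` with `‖a‖_{p'} ≤ 1`. -/
noncomputable def lpSum (p : ℝ≥0∞) {n : ℕ} (x : Fin n → Y) : Y :=
  (exists_isLUB_lpSumSet p x).choose

theorem isLUB_lpSum (p : ℝ≥0∞) {n : ℕ} (x : Fin n → Y) : IsLUB (lpSumSet p x) (lpSum p x) :=
  (exists_isLUB_lpSumSet p x).choose_spec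

theorem lpSum_nonneg (p : ℝ≥0∞) {n : ℕ} (x : Fin n → Y) : 0 ≤ lpSum p x :=
  (isLUB_lpSum p x).1 ⟨0, by simp, by simp⟩

theorem norm_lpSum_add_le (p : ℝ≥0∞) {n : ℕ} (x y : Fin n → Y) :
    ‖lpSum p (x + y)‖ ≤ ‖lpSum p x‖ + ‖lpSum p y‖ := by
  refine le_trans (norm_le_norm_of_abs_le_abs ?_) (norm_add_le _ _)
  rw [abs_of_nonneg (lpSum_nonneg p _),
    abs_of_nonneg (add_nonneg (lpSum_nonneg p _) (lpSum_nonneg p _))]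
  refine (isLUB_lpSum p _).2 ?_
  rintro _ ⟨a, ha, rfl⟩
  simp only [Pi.add_apply, smul_add, Finset.sum_add_distrib]
  exact add_le_add ((isLUB_lpSum p x).1 ⟨a, ha, rfl⟩) ((isLUB_lpSum p y).1 ⟨a, ha, rfl⟩)

theorem norm_lpSum_smul_le (p : ℝ≥0∞) (c : ℝ) {n : ℕ} (x : Fin n → Y) :
    ‖lpSum p (c • x)‖ ≤ |c| * ‖lpSum p x‖ := by
  rw [← Real.norm_eq_abs, ← norm_abs_eq_norm c, ← norm_smul]
  refine norm_le_norm_of_abs_le_abs ?_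
  rw [abs_of_nonneg (lpSum_nonneg p _),
    abs_of_nonneg (smul_nonneg (abs_nonneg c) (lpSum_nonneg p _))]
  refine (isLUB_lpSum p _).2 ?_
  rintro _ ⟨a, ha, rfl⟩
  have h : ∑ i, a i • (c • x) i = c • ∑ i, a i • x i := by
    rw [Finset.smul_sum]
    exact Finset.sum_congr rfl fun i _ => smul_comm _ _ _
  rw [h]
  rcases le_total 0 c with hc | hc
  · rw [abs_of_nonneg hc]
    exact smul_le_smul_of_nonneg_left ((isLUB_lpSum p x).1 ⟨a, ha, rfl⟩) hc
  · rw [abs_of_nonpos hc]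
    have := smul_le_smul_of_nonneg_left
      ((isLUB_lpSum p x).1 ⟨-a, by simpa using ha, rfl⟩) (neg_nonneg.2 hc)
    simpa using this

end LpSum

section Operators

variable (p q : ℝ≥0∞) (X Y : Type*)

/-- `(p, q)`-convexity with constant `C` of a linear map from a Banach space to a Banach lattice:
`‖(∑ |T xᵢ| ^ p) ^ (1 / p)‖ ≤ C (∑ ‖xᵢ‖ ^ q) ^ (1 / q)`. -/
def IsPQConvexWith {X Y} [NormedAddCommGroup X] [NormedSpace ℝ X]
    [NormedAddCommGroup Y] [Lattice Y] [HasSolidNorm Y] [IsOrderedAddMonoid Y]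
    [NormedSpace ℝ Y] [IsOrderedModule ℝ Y] [CompleteSpace Y] (C : ℝ) (T : X →ₗ[ℝ] Y) : Prop :=
  ∀ (n : ℕ) (x : Fin n → X), ‖lpSum p fun i => T (x i)‖ ≤ C * ‖WithLp.toLp q x‖

/-- The space `𝒞𝒳_{p,q}(X, Y)` of `(p, q)`-convex operators. -/
def PQConvex [NormedAddCommGroup X] [NormedSpace ℝ X]
    [NormedAddCommGroup Y] [Lattice Y] [HasSolidNorm Y] [IsOrderedAddMonoid Y]
    [NormedSpace ℝ Y] [IsOrderedModule ℝ Y] [CompleteSpace Y] : Submodule ℝ (X →ₗ[ℝ] Y) where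
  carrier := {T | ∃ C : ℝ, 0 ≤ C ∧ IsPQConvexWith p q C T}
  add_mem' := by
    rintro S T ⟨C, hC, hS⟩ ⟨D, hD, hT⟩
    refine ⟨C + D, add_nonneg hC hD, fun n x => ?_⟩
    rw [add_mul]
    exact (norm_lpSum_add_le p _ _).trans (add_le_add (hS n x) (hT n x))
  zero_mem' := by
    refine ⟨0, le_rfl, fun n x => ?_⟩
    have := norm_lpSum_smul_le p 0 (0 : Fin n → Y)
    simp only [zero_smul, abs_zero, zero_mul] at this ⊢
    exact this
  smul_mem' := by
    rintro c T ⟨C, hC, hT⟩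
    refine ⟨|c| * C, mul_nonneg (abs_nonneg c) hC, fun n x => ?_⟩
    rw [mul_assoc]
    exact (norm_lpSum_smul_le p c _).trans (mul_le_mul_of_nonneg_left (hT n x) (abs_nonneg c))

/-- The norm of `𝒞𝒳_{p,q}(X, Y)`: the least `(p, q)`-convexity constant. -/
noncomputable def pqConvexConst {X Y} [NormedAddCommGroup X] [NormedSpace ℝ X]
    [NormedAddCommGroup Y] [Lattice Y] [HasSolidNorm Y] [IsOrderedAddMonoid Y]
    [NormedSpace ℝ Y] [IsOrderedModule ℝ Y] [CompleteSpace Y] (T : X →ₗ[ℝ] Y) : ℝ :=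
  sInf {C : ℝ | 0 ≤ C ∧ IsPQConvexWith p q C T}

/-- `(p, q)`-concavity with constant `C` of a linear map from a Banach lattice to a Banach space:
`(∑ ‖T xᵢ‖ ^ p) ^ (1 / p) ≤ C ‖(∑ |xᵢ| ^ q) ^ (1 / q)‖`. -/
def IsPQConcaveWith {X Y} [NormedAddCommGroup X] [Lattice X] [HasSolidNorm X]
    [IsOrderedAddMonoid X] [NormedSpace ℝ X] [IsOrderedModule ℝ X] [CompleteSpace X]
    [NormedAddCommGroup Y] [NormedSpace ℝ Y] (C : ℝ) (T : X →ₗ[ℝ] Y) : Prop :=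
  ∀ (n : ℕ) (x : Fin n → X), ‖WithLp.toLp p fun i => T (x i)‖ ≤ C * ‖lpSum q x‖

/-- The space `𝒞𝒞_{p,q}(X, Y)` of `(p, q)`-concave operators. -/
def PQConcave [Fact (1 ≤ p)] [NormedAddCommGroup X] [Lattice X] [HasSolidNorm X]
    [IsOrderedAddMonoid X] [NormedSpace ℝ X] [IsOrderedModule ℝ X] [CompleteSpace X]
    [NormedAddCommGroup Y] [NormedSpace ℝ Y] : Submodule ℝ (X →ₗ[ℝ] Y) where
  carrier := {T | ∃ C : ℝ, 0 ≤ C ∧ IsPQConcaveWith p q C T}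
  add_mem' := by
    rintro S T ⟨C, hC, hS⟩ ⟨D, hD, hT⟩
    refine ⟨C + D, add_nonneg hC hD, fun n x => ?_⟩
    rw [add_mul]
    exact (norm_add_le (WithLp.toLp p fun i => S (x i)) (WithLp.toLp p fun i => T (x i))).trans
      (add_le_add (hS n x) (hT n x))
  zero_mem' := by
    refine ⟨0, le_rfl, fun n x => ?_⟩
    rw [zero_mul]
    exact (norm_zero (E := PiLp p fun _ : Fin n => Y)).le
  smul_mem' := by
    rintro c T ⟨C, hC, hT⟩
    refine ⟨|c| * C, mul_nonneg (abs_nonneg c) hC, fun n x => ?_⟩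
    rw [mul_assoc]
    exact (norm_smul c (WithLp.toLp p fun i => T (x i))).le.trans
      (mul_le_mul_of_nonneg_left (hT n x) (abs_nonneg c))

/-- The norm of `𝒞𝒞_{p,q}(X, Y)`: the least `(p, q)`-concavity constant. -/
noncomputable def pqConcaveConst {X Y} [NormedAddCommGroup X] [Lattice X] [HasSolidNorm X]
    [IsOrderedAddMonoid X] [NormedSpace ℝ X] [IsOrderedModule ℝ X] [CompleteSpace X]
    [NormedAddCommGroup Y] [NormedSpace ℝ Y] (T : X →ₗ[ℝ] Y) : ℝ :=
  sInf {C : ℝ | 0 ≤ C ∧ IsPQConcaveWith p q C T}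

end Operators

section Tensor

/-- `inf {∑ j, φ (z j) : z = ∑ j, z j}`, for a nonnegative positively homogeneous `φ`. -/
noncomputable def sumHullSeminorm {E : Type*} [AddCommGroup E] [Module ℝ E] (φ : E → ℝ)
    (h0 : ∀ z, 0 ≤ φ z) (hs : ∀ (c : ℝ) (z : E), φ (c • z) ≤ |c| * φ z) : Seminorm ℝ E :=
  have hne : ∀ z : E,
      {r : ℝ | ∃ (m : ℕ) (w : Fin m → E), z = ∑ j, w j ∧ r = ∑ j, φ (w j)}.Nonempty :=
    fun z => ⟨φ z, 1, fun _ => z, by simp, by simp⟩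
  have hbdd : ∀ z : E,
      BddBelow {r : ℝ | ∃ (m : ℕ) (w : Fin m → E), z = ∑ j, w j ∧ r = ∑ j, φ (w j)} := by
    refine fun z => ⟨0, ?_⟩
    rintro _ ⟨m, w, -, rfl⟩
    exact Finset.sum_nonneg fun j _ => h0 _
  Seminorm.ofSMulLE
    (fun z => sInf {r : ℝ | ∃ (m : ℕ) (w : Fin m → E), z = ∑ j, w j ∧ r = ∑ j, φ (w j)})
    (by
      apply le_antisymm
      · exact csInf_le (hbdd 0) ⟨0, Fin.elim0, by simp, by simp⟩
      · refine le_csInf (hne 0) ?_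
        rintro _ ⟨m, w, -, rfl⟩
        exact Finset.sum_nonneg fun j _ => h0 _)
    (by
      intro y z
      rw [← sub_le_iff_le_add]
      refine le_csInf (hne y) ?_
      rintro _ ⟨m, w, hw, rfl⟩
      rw [sub_le_comm]
      refine le_csInf (hne z) ?_
      rintro _ ⟨m', w', hw', rfl⟩
      rw [sub_le_iff_le_add']
      refine csInf_le (hbdd _) ⟨m + m', Fin.append w w', ?_, ?_⟩
      · simp [Fin.sum_univ_add, hw, hw']
      · simp [Fin.sum_univ_add])
    (by
      intro c z
      rw [Real.norm_eq_abs]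
      have h1 : ∀ (m : ℕ) (w : Fin m → E), z = ∑ j, w j →
          sInf {r : ℝ | ∃ (m : ℕ) (w : Fin m → E), c • z = ∑ j, w j ∧ r = ∑ j, φ (w j)} ≤
            |c| * ∑ j, φ (w j) := by
        intro m w hw
        refine (csInf_le (hbdd _) ⟨m, fun j => c • w j, ?_, rfl⟩).trans ?_
        · rw [hw, Finset.smul_sum]
        · rw [Finset.mul_sum]
          exact Finset.sum_le_sum fun j _ => hs c _
      rcases (abs_nonneg c).eq_or_lt with hc | hc
      · rw [← hc, zero_mul]
        simpa [← hc] using h1 1 (fun _ => z) (by simp)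
      · rw [← div_le_iff₀' hc]
        refine le_csInf (hne z) ?_
        rintro _ ⟨m, w, hw, rfl⟩
        rw [div_le_iff₀' hc]
        exact h1 m w hw)

theorem exists_tensor_eq_sum {X Y : Type*} [AddCommGroup X] [Module ℝ X] [AddCommGroup Y]
    [Module ℝ Y] (z : X ⊗[ℝ] Y) :
    ∃ (n : ℕ) (x : Fin n → X) (y : Fin n → Y), z = ∑ i, x i ⊗ₜ[ℝ] y i := by
  induction z with
  | zero => exact ⟨0, Fin.elim0, Fin.elim0, by simp⟩
  | tmul x y => exact ⟨1, fun _ => x, fun _ => y, by simp⟩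
  | add z₁ z₂ h₁ h₂ =>
    obtain ⟨n, x, y, rfl⟩ := h₁
    obtain ⟨m, x', y', rfl⟩ := h₂
    exact ⟨n + m, Fin.append x x', Fin.append y y', by simp [Fin.sum_univ_add]⟩

section H

variable {X Y : Type*} [NormedAddCommGroup X] [NormedSpace ℝ X]
  [NormedAddCommGroup Y] [Lattice Y] [HasSolidNorm Y] [IsOrderedAddMonoid Y]
  [NormedSpace ℝ Y] [IsOrderedModule ℝ Y] [CompleteSpace Y]

/-- `δ_{p,q}(z) = inf (∑ ‖xᵢ‖ ^ q) ^ (1 / q) ‖(∑ |yᵢ| ^ p') ^ (1 / p')‖` over all representations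
`z = ∑ xᵢ ⊗ yᵢ`. -/
noncomputable def tensorDelta (p q : ℝ≥0∞) (z : X ⊗[ℝ] Y) : ℝ :=
  sInf {r : ℝ | ∃ (n : ℕ) (x : Fin n → X) (y : Fin n → Y), z = ∑ i, x i ⊗ₜ[ℝ] y i ∧
    r = ‖WithLp.toLp q x‖ * ‖lpSum p.conjExponent y‖}

theorem tensorDelta_nonneg (p q : ℝ≥0∞) [Fact (1 ≤ q)] (z : X ⊗[ℝ] Y) :
    0 ≤ tensorDelta p q z := by
  refine Real.sInf_nonneg ?_
  rintro _ ⟨n, x, y, -, rfl⟩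
  positivity

theorem tensorDelta_smul_le (p q : ℝ≥0∞) [Fact (1 ≤ q)] (c : ℝ) (z : X ⊗[ℝ] Y) :
    tensorDelta p q (c • z) ≤ |c| * tensorDelta p q z := by
  obtain ⟨n, x, y, hz⟩ := exists_tensor_eq_sum z
  have hbdd : ∀ w : X ⊗[ℝ] Y, BddBelow {r : ℝ | ∃ (n : ℕ) (x : Fin n → X) (y : Fin n → Y),
      w = ∑ i, x i ⊗ₜ[ℝ] y i ∧ r = ‖WithLp.toLp q x‖ * ‖lpSum p.conjExponent y‖} := by
    refine fun w => ⟨0, ?_⟩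
    rintro _ ⟨n, x, y, -, rfl⟩
    positivity
  have h1 : ∀ (n : ℕ) (x : Fin n → X) (y : Fin n → Y), z = ∑ i, x i ⊗ₜ[ℝ] y i →
      tensorDelta p q (c • z) ≤ |c| * (‖WithLp.toLp q x‖ * ‖lpSum p.conjExponent y‖) := by
    intro n x y hz
    refine (csInf_le (hbdd _) ⟨n, x, c • y, by simp [hz, Finset.smul_sum], rfl⟩).trans ?_
    rw [mul_left_comm]
    exact mul_le_mul_of_nonneg_left (norm_lpSum_smul_le _ c y) (norm_nonneg _)
  rcases (abs_nonneg c).eq_or_lt with hc | hc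
  · rw [← hc, zero_mul]
    simpa [← hc] using h1 n x y hz
  · rw [← div_le_iff₀' hc]
    refine le_csInf ⟨_, n, x, y, hz, rfl⟩ ?_
    rintro _ ⟨n, x, y, hz, rfl⟩
    rw [div_le_iff₀' hc]
    exact h1 n x y hz

variable (X Y) in
/-- The norm `h_{p,q}(z) = inf {∑ j, δ_{p,q}(z j) : z = ∑ j, z j}` on `X ⊗ Y`. -/
noncomputable def tensorH (p q : ℝ≥0∞) [Fact (1 ≤ q)] : Seminorm ℝ (X ⊗[ℝ] Y) :=
  sumHullSeminorm (tensorDelta p q) (tensorDelta_nonneg p q) (tensorDelta_smul_le p q)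

end H

section K

variable {X Y : Type*} [NormedAddCommGroup X] [Lattice X] [HasSolidNorm X]
  [IsOrderedAddMonoid X] [NormedSpace ℝ X] [IsOrderedModule ℝ X] [CompleteSpace X]
  [NormedAddCommGroup Y] [NormedSpace ℝ Y]

/-- `ι_{p,q}(z) = inf ‖(∑ |xᵢ| ^ q) ^ (1 / q)‖ (∑ ‖yᵢ‖ ^ p') ^ (1 / p')` over all representations
`z = ∑ xᵢ ⊗ yᵢ`. -/
noncomputable def tensorIota (p q : ℝ≥0∞) (z : X ⊗[ℝ] Y) : ℝ :=
  sInf {r : ℝ | ∃ (n : ℕ) (x : Fin n → X) (y : Fin n → Y), z = ∑ i, x i ⊗ₜ[ℝ] y i ∧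
    r = ‖lpSum q x‖ * ‖WithLp.toLp p.conjExponent y‖}

theorem tensorIota_nonneg (p q : ℝ≥0∞) (z : X ⊗[ℝ] Y) : 0 ≤ tensorIota p q z := by
  refine Real.sInf_nonneg ?_
  rintro _ ⟨n, x, y, -, rfl⟩
  positivity

theorem tensorIota_smul_le (p q : ℝ≥0∞) (c : ℝ) (z : X ⊗[ℝ] Y) :
    tensorIota p q (c • z) ≤ |c| * tensorIota p q z := by
  obtain ⟨n, x, y, hz⟩ := exists_tensor_eq_sum z
  have hbdd : ∀ w : X ⊗[ℝ] Y, BddBelow {r : ℝ | ∃ (n : ℕ) (x : Fin n → X) (y : Fin n → Y),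
      w = ∑ i, x i ⊗ₜ[ℝ] y i ∧ r = ‖lpSum q x‖ * ‖WithLp.toLp p.conjExponent y‖} := by
    refine fun w => ⟨0, ?_⟩
    rintro _ ⟨n, x, y, -, rfl⟩
    positivity
  have h1 : ∀ (n : ℕ) (x : Fin n → X) (y : Fin n → Y), z = ∑ i, x i ⊗ₜ[ℝ] y i →
      tensorIota p q (c • z) ≤ |c| * (‖lpSum q x‖ * ‖WithLp.toLp p.conjExponent y‖) := by
    intro n x y hz
    refine (csInf_le (hbdd _) ⟨n, c • x, y,
      by simp [hz, Finset.smul_sum, TensorProduct.smul_tmul'], rfl⟩).trans ?_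
    rw [← mul_assoc]
    exact mul_le_mul_of_nonneg_right (norm_lpSum_smul_le _ c x) (norm_nonneg _)
  rcases (abs_nonneg c).eq_or_lt with hc | hc
  · rw [← hc, zero_mul]
    simpa [← hc] using h1 n x y hz
  · rw [← div_le_iff₀' hc]
    refine le_csInf ⟨_, n, x, y, hz, rfl⟩ ?_
    rintro _ ⟨n, x, y, hz, rfl⟩
    rw [div_le_iff₀' hc]
    exact h1 n x y hz

variable (X Y) in
/-- The norm `k_{p,q}(z) = inf {∑ j, ι_{p,q}(z j) : z = ∑ j, z j}` on `X ⊗ Y`. -/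
noncomputable def tensorK (p q : ℝ≥0∞) : Seminorm ℝ (X ⊗[ℝ] Y) :=
  sumHullSeminorm (tensorIota p q) (tensorIota_nonneg p q) (tensorIota_smul_le p q)

end K

/-- The vector space `E` with the topology and the norm given by the seminorm `s`. -/
def SeminormedBy {E : Type*} [AddCommGroup E] [Module ℝ E] (_s : Seminorm ℝ E) : Type _ := E

noncomputable instance SeminormedBy.instSeminormedAddCommGroup {E : Type*} [AddCommGroup E]
    [Module ℝ E] (s : Seminorm ℝ E) : SeminormedAddCommGroup (SeminormedBy s) :=
  s.toAddGroupSeminorm.toSeminormedAddCommGroup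

noncomputable instance SeminormedBy.instModule {E : Type*} [AddCommGroup E] [Module ℝ E]
    (s : Seminorm ℝ E) : Module ℝ (SeminormedBy s) :=
  inferInstanceAs (Module ℝ E)

noncomputable instance SeminormedBy.instNormedSpace {E : Type*} [AddCommGroup E] [Module ℝ E]
    (s : Seminorm ℝ E) : NormedSpace ℝ (SeminormedBy s) where
  norm_smul_le c z := (map_smul_eq_mul s c z).le

/-- The identity map from `E` to `E` with the norm `s`. -/
def SeminormedBy.of {E : Type*} [AddCommGroup E] [Module ℝ E] (s : Seminorm ℝ E) :
    E ≃ₗ[ℝ] SeminormedBy s :=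
  LinearEquiv.refl ℝ E

/-- `(X ⊗_s Y*)* ∩ ℒ(X, Y)`: the bounded functionals `φ` on `X ⊗ Y*` with the norm `s` that are
given, through trace duality `φ (x ⊗ y*) = ⟨T x, y*⟩`, by a bounded operator `T : X → Y`
(that is, the operator `X → Y**` associated with `φ` takes its values in `Y`). -/
def dualInterOperators {X Y : Type*} [NormedAddCommGroup X] [NormedSpace ℝ X]
    [NormedAddCommGroup Y] [NormedSpace ℝ Y] (s : Seminorm ℝ (X ⊗[ℝ] StrongDual ℝ Y)) :
    Submodule ℝ (StrongDual ℝ (SeminormedBy s)) where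
  carrier := {φ | ∃ T : X →L[ℝ] Y, ∀ (x : X) (y' : StrongDual ℝ Y),
    φ (SeminormedBy.of s (x ⊗ₜ[ℝ] y')) = y' (T x)}
  add_mem' := by
    rintro φ ψ ⟨S, hS⟩ ⟨T, hT⟩
    exact ⟨S + T, fun x y' => by simp [hS, hT]⟩
  zero_mem' := ⟨0, fun x y' => by simp⟩
  smul_mem' := by
    rintro c φ ⟨S, hS⟩
    exact ⟨c • S, fun x y' => by simp [hS]⟩

end Tensor

/-! Trace duality sends `T` to the functional `x ⊗ y' ↦ y' (T x)`. A linear functional dominated by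
`C` times a gauge is dominated by `C` times its sum hull, so `h` and `k` may be replaced by `δ` and
`ι`. It remains to see that the defining inequality of `T` with constant `C` is the bound `C` for
its trace functional. For concavity this is the duality of `ℓ_p(Y)` and `ℓ_{p'}(Y*)`. For convexity
it is the corresponding duality of `lpSum p` on a Banach lattice and `lpSum p'` on its dual: the
Hölder inequality `sum_dual_apply_le_lpSum` and its sharpness `exists_norm_lpSum_le_sum_dual_apply`.

Sharpness is Hahn–Banach for the sublinear map `f ∘ lpSum p` with `f ≥ 0`. Hölder's inequality is
proved inside the lattice, without representing it by functions. With `u = lpSum p y`, think of `y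
i` as a function with values in `[-1, 1]` times `u`. A partition of `u` into hat functions gives `u
= ∑ w k` and, exactly, `y i = ∑ c k i • w k`, where `y i` is within `ε • u` of `c k i • u` on the
support of `w k`. Hence `c k` has `ℓ_p` norm at most `1 + n * ε` unless `w k = 0`. The definition of
`lpSum` in the dual then bounds each `∑ i, c k i * g i (w k)`; summing over `k` and letting `ε → 0`
gives the inequality. -/

/-! ### Duality of finite `ℓ_p` sums, endpoints included. -/

section PiLpDuality

variable {ι X Y : Type*} [Fintype ι] [SeminormedAddCommGroup X] [SeminormedAddCommGroup Y]

theorem sum_norm_mul_norm_le_toLp_one_top (x : ι → X) (y : ι → Y) :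
    ∑ i, ‖x i‖ * ‖y i‖ ≤ ‖WithLp.toLp 1 x‖ * ‖WithLp.toLp ∞ y‖ := by
  rw [PiLp.norm_eq_of_L1, Finset.sum_mul]
  exact Finset.sum_le_sum fun i _ =>
    mul_le_mul_of_nonneg_left (PiLp.norm_apply_le (WithLp.toLp ∞ y) i) (norm_nonneg _)

theorem sum_norm_mul_norm_le_toLp (p q : ℝ≥0∞) [hpq : p.HolderConjugate q] (x : ι → X)
    (y : ι → Y) : ∑ i, ‖x i‖ * ‖y i‖ ≤ ‖WithLp.toLp p x‖ * ‖WithLp.toLp q y‖ := by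
  rcases eq_or_ne q ∞ with rfl | hq
  · obtain rfl := ENNReal.HolderConjugate.unique ∞ p 1
    exact sum_norm_mul_norm_le_toLp_one_top x y
  rcases eq_or_ne p ∞ with rfl | hp
  · obtain rfl := ENNReal.HolderConjugate.unique ∞ q 1
    simpa only [mul_comm] using sum_norm_mul_norm_le_toLp_one_top y x
  have h := ENNReal.HolderConjugate.toReal_of_ne_top (p := p) (q := q) hp hq
  rw [PiLp.norm_eq_sum h.pos, PiLp.norm_eq_sum h.symm.pos]
  exact Real.inner_le_Lp_mul_Lq_of_nonneg _ h (fun i _ => norm_nonneg _) fun i _ => norm_nonneg _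

theorem exists_sum_mul_norm_eq_toLp (p q : ℝ≥0∞) [hpq : p.HolderConjugate q] (x : ι → X) :
    ∃ a : ι → ℝ, ‖WithLp.toLp q a‖ ≤ 1 ∧ ∑ i, a i * ‖x i‖ = ‖WithLp.toLp p x‖ := by
  classical
  rcases eq_or_ne q ∞ with rfl | hq
  · obtain rfl := ENNReal.HolderConjugate.unique ∞ p 1
    refine ⟨fun _ => 1, ?_, by simp [PiLp.norm_eq_of_L1]⟩
    rw [PiLp.norm_toLp]
    exact (pi_norm_le_iff_of_nonneg zero_le_one).2 fun i => by simp
  rcases eq_or_ne p ∞ with rfl | hp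
  · obtain rfl := ENNReal.HolderConjugate.unique ∞ q 1
    rw [PiLp.norm_eq_ciSup]
    cases isEmpty_or_nonempty ι
    · exact ⟨fun _ => 0, by simp [PiLp.norm_eq_of_L1], by simp⟩
    -- For `p = ∞` the norming vector is the unit vector at an index of largest norm.
    · obtain ⟨j, hj⟩ := exists_eq_ciSup_of_finite (f := fun i => ‖x i‖)
      refine ⟨Pi.single j 1, by simp, ?_⟩
      rw [← hj]
      simp [Pi.single_apply]
  have h := ENNReal.HolderConjugate.toReal_of_ne_top (p := p) (q := q) hp hq
  obtain ⟨g, hg, hsum⟩ := (NNReal.isGreatest_Lp Finset.univ (fun i => ‖x i‖₊) h).1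
  refine ⟨fun i => g i, ?_, ?_⟩
  · rw [PiLp.norm_eq_sum h.symm.pos]
    refine Real.rpow_le_one (by positivity) ?_ (by have := h.symm.pos; positivity)
    simpa using! (NNReal.coe_le_coe.2 hg)
  · rw [PiLp.norm_eq_sum h.pos]
    have := congrArg NNReal.toReal hsum
    push_cast at this
    simpa [mul_comm] using! this

/-- A vector norming `x` is tested against `y`; this treats all exponents at once. -/
theorem norm_toLp_le_norm_toLp (p q : ℝ≥0∞) [hpq : p.HolderConjugate q] {x : ι → X} {y : ι → Y}
    (h : ∀ i, ‖x i‖ ≤ ‖y i‖) : ‖WithLp.toLp p x‖ ≤ ‖WithLp.toLp p y‖ := by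
  have : Fact (1 ≤ p) := ⟨ENNReal.HolderConjugate.one_le p q⟩
  obtain ⟨a, ha, hsum⟩ := exists_sum_mul_norm_eq_toLp p q x
  calc ‖WithLp.toLp p x‖ = ∑ i, a i * ‖x i‖ := hsum.symm
    _ ≤ ∑ i, ‖y i‖ * ‖a i‖ := Finset.sum_le_sum fun i _ => by
        rw [mul_comm]
        exact (mul_le_mul_of_nonneg_left (le_abs_self _) (norm_nonneg _)).trans
          (mul_le_mul_of_nonneg_right (h i) (abs_nonneg _))
    _ ≤ ‖WithLp.toLp p y‖ * ‖WithLp.toLp q a‖ := sum_norm_mul_norm_le_toLp p q y a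
    _ ≤ ‖WithLp.toLp p y‖ := mul_le_of_le_one_right (norm_nonneg _) ha

theorem sum_dual_apply_le_toLp {E : Type*} [NormedAddCommGroup E] [NormedSpace ℝ E]
    (p q : ℝ≥0∞) [hpq : p.HolderConjugate q] (x : ι → E) (f : ι → StrongDual ℝ E) :
    ∑ i, f i (x i) ≤ ‖WithLp.toLp p x‖ * ‖WithLp.toLp q f‖ :=
  (Finset.sum_le_sum fun i _ => (le_abs_self _).trans
    (((f i).le_opNorm (x i)).trans_eq (mul_comm _ _))).trans (sum_norm_mul_norm_le_toLp p q x f)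

theorem exists_sum_dual_apply_eq_toLp {E : Type*} [NormedAddCommGroup E] [NormedSpace ℝ E]
    (p q : ℝ≥0∞) [hpq : p.HolderConjugate q] (x : ι → E) :
    ∃ f : ι → StrongDual ℝ E, ‖WithLp.toLp q f‖ ≤ 1 ∧ ∑ i, f i (x i) = ‖WithLp.toLp p x‖ := by
  obtain ⟨a, ha, hsum⟩ := exists_sum_mul_norm_eq_toLp p q x
  choose φ hφ hφx using fun i => exists_dual_vector'' ℝ (x i)
  refine ⟨fun i => a i • φ i, (norm_toLp_le_norm_toLp (hpq := hpq.symm) q p fun i => ?_).trans ha, ?_⟩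
  · rw [norm_smul]
    exact mul_le_of_le_one_right (norm_nonneg _) (hφ i)
  · rw [← hsum]
    exact Finset.sum_congr rfl fun i _ => by simp [hφx]

/-- The signed version for scalars: a functional on `ℝ` is multiplication by its value at `1`. -/
theorem exists_sum_mul_eq_toLp (p q : ℝ≥0∞) [hpq : p.HolderConjugate q] (c : ι → ℝ) :
    ∃ a : ι → ℝ, ‖WithLp.toLp q a‖ ≤ 1 ∧ ∑ i, a i * c i = ‖WithLp.toLp p c‖ := by
  obtain ⟨f, hf, hsum⟩ := exists_sum_dual_apply_eq_toLp p q c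
  refine ⟨fun i => f i 1, (norm_toLp_le_norm_toLp (hpq := hpq.symm) q p fun i => ?_).trans hf, ?_⟩
  · simpa using (f i).le_opNorm 1
  · rw [← hsum]
    refine Finset.sum_congr rfl fun i _ => ?_
    have := (f i).map_smul (c i) 1
    simp only [smul_eq_mul, mul_one] at this
    rw [this, mul_comm]

end PiLpDuality

/-! ### Second differences, Riesz decomposition and lattice identities. -/

theorem sum_range_second_difference {Y : Type*} [AddCommGroup Y] (P : ℕ → Y) (n : ℕ) :
    ∑ j ∈ Finset.range n, (P j + P (j + 2) - (P (j + 1) + P (j + 1))) =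
      P 0 - P 1 - P n + P (n + 1) := by
  induction n with
  | zero => simp
  | succ n ih => rw [Finset.sum_range_succ, ih]; abel

theorem sum_range_nsmul_second_difference {Y : Type*} [AddCommGroup Y] (P : ℕ → Y) (n : ℕ) :
    ∑ j ∈ Finset.range n, j • (P j + P (j + 2) - (P (j + 1) + P (j + 1))) =
      P 1 - n • P n + n • P (n + 1) - P (n + 1) := by
  induction n with
  | zero => simp
  | succ n ih =>
    rw [Finset.sum_range_succ, ih]
    simp only [smul_sub, smul_add, add_smul, one_smul]
    abel

section RieszDecomposition

variable {Y : Type*} [AddCommGroup Y] [Lattice Y] [IsOrderedAddMonoid Y]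

/-- Riesz decomposition: `x ⊓ v j` is split off, and what remains of `x` lies below the sum of the
other `v k`. -/
theorem exists_sum_eq_of_le_sum {κ : Type*} (s : Finset κ) (v : κ → Y) (hv : ∀ k, 0 ≤ v k)
    (x : Y) (h0 : 0 ≤ x) (hx : x ≤ ∑ k ∈ s, v k) :
    ∃ w : κ → Y, (∀ k, 0 ≤ w k) ∧ (∀ k, w k ≤ v k) ∧ ∑ k ∈ s, w k = x := by
  classical
  induction s using Finset.induction_on generalizing x with
  | empty => exact ⟨0, fun _ => le_rfl, hv, by simpa using le_antisymm h0 (by simpa using hx)⟩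
  | insert j s hj ih =>
    rw [Finset.sum_insert hj] at hx
    obtain ⟨w, hw0, hwv, hw⟩ := ih (x - x ⊓ v j) (sub_nonneg.2 inf_le_left) (by
      rw [sub_le_iff_le_add, ← sub_le_iff_le_add']
      refine le_inf (sub_le_self _ (Finset.sum_nonneg fun k _ => hv k)) ?_
      rwa [sub_le_iff_le_add])
    refine ⟨Function.update w j (x ⊓ v j), fun k => ?_, fun k => ?_, ?_⟩
    · rcases eq_or_ne k j with rfl | hk
      · simpa using ⟨h0, hv k⟩
      · simpa [hk] using hw0 k
    · rcases eq_or_ne k j with rfl | hk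
      · simp
      · simpa [hk] using hwv k
    · rw [Finset.sum_insert hj, Finset.sum_update_of_notMem hj, hw]
      simp

/-- Each `a i` in turn is distributed over the `b j`, and the amounts used are subtracted from the
`b j`. This lets partitions adapted to different `y i` be merged into one. -/
theorem exists_common_refinement {κ l : Type*} [Fintype l] (s : Finset κ) (a : κ → Y) (b : l → Y)
    (ha : ∀ k, 0 ≤ a k) (hb : ∀ j, 0 ≤ b j) (hab : ∑ k ∈ s, a k = ∑ j, b j) :
    ∃ w : κ → l → Y, (∀ k j, 0 ≤ w k j) ∧ (∀ k ∈ s, ∑ j, w k j = a k) ∧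
      ∀ j, ∑ k ∈ s, w k j = b j := by
  classical
  induction s using Finset.induction_on generalizing b with
  | empty =>
    refine ⟨0, fun _ _ => le_rfl, by simp, fun j => ?_⟩
    have := (Finset.sum_eq_zero_iff_of_nonneg fun j _ => hb j).1 (by simpa using hab.symm)
    simpa using (this j (Finset.mem_univ j)).symm
  | insert i s hi ih =>
    rw [Finset.sum_insert hi] at hab
    obtain ⟨x, hx0, hxb, hx⟩ := exists_sum_eq_of_le_sum Finset.univ b hb (a i) (ha i) (by
      rw [← hab]
      exact le_add_of_nonneg_right (Finset.sum_nonneg fun k _ => ha k))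
    obtain ⟨w, hw0, hwa, hwb⟩ := ih (fun j => b j - x j) (fun j => sub_nonneg.2 (hxb j)) (by
      rw [Finset.sum_sub_distrib, hx, ← hab]
      abel)
    refine ⟨Function.update w i x, fun k j => ?_, fun k hk => ?_, fun j => ?_⟩
    · rcases eq_or_ne k i with rfl | hk
      · simpa using hx0 j
      · simpa [hk] using hw0 k j
    · rcases eq_or_ne k i with rfl | hki
      · simpa using hx
      · simpa [hki] using hwa k ((Finset.mem_insert.1 hk).resolve_left hki)
    · rw [Finset.sum_insert hi, Function.update_self]
      have : ∑ k ∈ s, Function.update w i x k j = ∑ k ∈ s, w k j :=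
        Finset.sum_congr rfl fun k hk => by
          rw [Function.update_of_ne (ne_of_mem_of_not_mem hk hi)]
      rw [this, hwb]
      abel

/-- The hat function `(u - |z|)⁺` is a second difference of positive parts. -/
theorem posPart_sub_abs {u : Y} (hu : 0 ≤ u) (z : Y) :
    (u - |z|)⁺ = (z + u)⁺ + (z - u)⁺ - (z⁺ + z⁺) := by
  rw [eq_sub_iff_add_eq]
  have h1 : (u - |z|)⁺ + (z⁺ + z⁺) = (z + u) ⊔ (z⁺ + z⁺) := by
    rw [posPart_def (u - |z|), sup_add, zero_add]
    congr 1
    calc u - |z| + (z⁺ + z⁺) = u + (z⁺ - z⁻) := by rw [← posPart_add_negPart z]; abel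
      _ = z + u := by rw [posPart_sub_negPart, add_comm]
  rw [h1]
  -- Both sides are now suprema of `z + u`, `z + z` and `0`; the remaining terms `z` and `z - u` lie
  -- below `z + u`.
  simp only [posPart_def, sup_add, add_sup, add_zero, zero_add]
  have h4 : z - u ≤ z + u := (sub_le_self z hu).trans (le_add_of_nonneg_right hu)
  have h5 : z ≤ z + u := le_add_of_nonneg_right hu
  have h6 : z + u + (z - u) = z + z := by abel
  rw [h6]
  apply le_antisymm
  · refine sup_le ?_ (sup_le (sup_le ?_ ?_) (sup_le ?_ ?_))
    all_goals first
      | exact le_sup_of_le_left le_sup_left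
      | exact le_sup_of_le_left le_sup_right
      | exact le_sup_of_le_right le_sup_left
      | exact le_sup_of_le_right le_sup_right
      | exact h5.trans (le_sup_of_le_left le_sup_right)
      | exact h5.trans (le_sup_of_le_right le_sup_left)
  · refine sup_le (sup_le ?_ ?_) (sup_le ?_ ?_)
    all_goals first
      | exact le_sup_left
      | exact h4.trans le_sup_left
      | exact le_sup_of_le_right (le_sup_of_le_left le_sup_left)
      | exact le_sup_of_le_right (le_sup_of_le_right le_sup_right)

/-- By distributivity the infimum of the `(z i)⁺` is the positive part of the infimum of the `z i`,
and `n` times the latter infimum is at most the sum. -/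
theorem nonpos_of_le_posPart_of_sum_nonpos [Module ℝ Y] [IsOrderedModule ℝ Y] {n : ℕ}
    (hn : 0 < n) (z : Fin n → Y) (hz : ∑ i, z i ≤ 0) (x : Y) (hx : ∀ i, x ≤ (z i)⁺) : x ≤ 0 := by
  let : DistribLattice Y := AddCommGroup.toDistribLattice Y
  have : Nonempty (Fin n) := ⟨⟨0, hn⟩⟩
  have hne : (Finset.univ : Finset (Fin n)).Nonempty := Finset.univ_nonempty
  have h1 : x ≤ Finset.univ.inf' hne z ⊔ 0 := by
    rw [Finset.inf'_sup_distrib_right]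
    exact Finset.le_inf' _ _ fun i _ => hx i
  have h2 : (n : ℝ) • Finset.univ.inf' hne z ≤ 0 := by
    refine le_trans ?_ hz
    rw [Nat.cast_smul_eq_nsmul]
    simpa using Finset.card_nsmul_le_sum Finset.univ z (Finset.univ.inf' hne z)
      fun i hi => Finset.inf'_le z hi
  have h3 : Finset.univ.inf' hne z ≤ 0 := by
    have := smul_le_smul_of_nonneg_left h2 (inv_nonneg.2 (Nat.cast_nonneg (α := ℝ) n))
    rwa [smul_zero, inv_smul_smul₀ (by positivity)] at this
  exact h1.trans (sup_le h3 le_rfl)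

end RieszDecomposition

theorem smul_le_abs_smul_abs {Y : Type*} [AddCommGroup Y] [Lattice Y] [Module ℝ Y]
    [IsOrderedModule ℝ Y] (a : ℝ) (y : Y) : a • y ≤ |a| • |y| := by
  rcases le_total 0 a with h | h
  · rw [abs_of_nonneg h]
    exact smul_le_smul_of_nonneg_left (le_abs_self _) h
  · rw [abs_of_nonpos h, ← neg_smul_neg]
    exact smul_le_smul_of_nonneg_left (neg_le_abs y) (neg_nonneg.2 h)

/-! ### Partitions into hat functions. -/

section HatDecomposition

variable {Y : Type*} [AddCommGroup Y] [Lattice Y] [IsOrderedAddMonoid Y]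

/-- Piecewise linear interpolation at equally spaced nodes reproduces constants and the identity.
Each hat is a second difference of the ramps `P`, so both sums telescope. -/
theorem sum_hat {v y : Y} {K : ℕ} (hv : 0 ≤ v) (hy : |y| ≤ K • v) :
    ∑ j ∈ Finset.range (2 * K + 1), (v - |y + K • v - j • v|)⁺ = v ∧
      ∑ j ∈ Finset.range (2 * K + 1), j • (v - |y + K • v - j • v|)⁺ = y + K • v := by
  set P : ℕ → Y := fun j => (y + K • v + v - j • v)⁺ with hP
  have hterm : ∀ j : ℕ, (v - |y + K • v - j • v|)⁺ = P j + P (j + 2) - (P (j + 1) + P (j + 1)) := by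
    intro j
    have e0 : y + K • v + v - j • v = y + K • v - j • v + v := by abel
    have e1 : y + K • v + v - (j + 1) • v = y + K • v - j • v := by
      rw [add_smul, one_smul]; abel
    have e2 : y + K • v + v - (j + 2) • v = y + K • v - j • v - v := by
      rw [add_smul, two_smul]; abel
    simp only [hP, e0, e1, e2, posPart_sub_abs hv]
  have hlow := neg_le_of_neg_le ((neg_le_abs y).trans hy)
  have hup := (le_abs_self y).trans hy
  have h1 : P 1 = y + K • v := by
    simp only [hP, one_smul, add_sub_cancel_right]
    exact posPart_of_nonneg (neg_le_iff_add_nonneg.1 hlow)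
  have h0 : P 0 = y + K • v + v := by
    simp only [hP, zero_smul, sub_zero]
    exact posPart_of_nonneg (add_nonneg (neg_le_iff_add_nonneg.1 hlow) hv)
  -- The ramps vanish past the last node because `y ≤ K • v`, so only the terms at `0` and `1`
  -- survive.
  have hN : P (2 * K + 1) = 0 := by
    refine posPart_of_nonpos ?_
    rw [add_smul, one_smul, mul_smul, two_smul, sub_nonpos]
    gcongr
  have hN1 : P (2 * K + 1 + 1) = 0 := by
    refine posPart_of_nonpos ?_
    rw [add_smul, add_smul, one_smul, mul_smul, two_smul, sub_nonpos]
    exact le_add_of_le_of_nonneg (by gcongr) hv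
  simp only [hterm]
  rw [sum_range_second_difference, sum_range_nsmul_second_difference, hN, hN1, h0, h1]
  exact ⟨by abel, by simp⟩

variable [Module ℝ Y] [IsOrderedModule ℝ Y]

theorem exists_hat_decomposition {u y : Y} (hy : |y| ≤ u) {ε : ℝ} (hε : 0 < ε) :
    ∃ (m : ℕ) (w : Fin m → Y) (c : Fin m → ℝ) (N : ℝ), 0 ≤ N ∧ (∀ k, 0 ≤ w k) ∧
      ∑ k, w k = u ∧ ∑ k, c k • w k = y ∧ ∀ k, w k ≤ N • (ε • u - |y - c k • u|)⁺ := by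
  have hu : 0 ≤ u := (abs_nonneg y).trans hy
  obtain ⟨K, hK⟩ := exists_nat_one_div_lt hε
  set M : ℕ := K + 1 with hM
  have hM0 : (M : ℝ) ≠ 0 := by positivity
  have hMε : (M : ℝ)⁻¹ ≤ ε := by simpa [hM] using hK.le
  set v : Y := (M : ℝ)⁻¹ • u with hv
  have hv0 : 0 ≤ v := smul_nonneg (by positivity) hu
  have huv : (M : ℝ) • v = u := smul_inv_smul₀ hM0 u
  have huv' : M • v = u := by rw [← huv, Nat.cast_smul_eq_nsmul]
  obtain ⟨h1, h2⟩ := sum_hat (K := M) hv0 (y := y) (by rwa [huv'])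
  rw [Finset.sum_range] at h1 h2
  have h1' : ∑ k : Fin (2 * M + 1), (M : ℝ) • (v - |y + M • v - (k : ℕ) • v|)⁺ = u := by
    rw [← Finset.smul_sum, h1, huv]
  -- The `2 * M + 1` nodes `k / M - 1` divide `[-1, 1]` with mesh `1 / M ≤ ε`. The hats sum to `v =
  -- u / M`, hence the factor `M`, which also serves as `N`.
  refine ⟨2 * M + 1, fun k => (M : ℝ) • (v - |y + M • v - (k : ℕ) • v|)⁺,
    fun k => (k : ℝ) * (M : ℝ)⁻¹ - 1, M, by positivity,
    fun k => smul_nonneg (by positivity) (posPart_nonneg _), h1', ?_, fun k => ?_⟩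
  · have hterm : ∀ (k : ℕ) (x : Y),
        ((k : ℝ) * (M : ℝ)⁻¹ - 1) • (M : ℝ) • x = k • x - (M : ℝ) • x := by
      intro k x
      rw [sub_smul, one_smul, smul_smul, inv_mul_cancel_right₀ hM0, Nat.cast_smul_eq_nsmul ℝ k]
    simp only [hterm, Finset.sum_sub_distrib, h1']
    rw [h2, huv', add_sub_cancel_right]
  · refine smul_le_smul_of_nonneg_left (posPart_mono ?_) (by positivity)
    have : y + M • v - (k : ℕ) • v = y - ((k : ℝ) * (M : ℝ)⁻¹ - 1) • u := by
      rw [huv', sub_smul, mul_smul, ← hv, one_smul, Nat.cast_smul_eq_nsmul]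
      abel
    rw [this]
    exact sub_le_sub_right (smul_le_smul_of_nonneg_right hMε hu) _

theorem exists_joint_hat_decomposition {n : ℕ} {u : Y} (hu : 0 ≤ u) (y : Fin n → Y)
    (hy : ∀ i, |y i| ≤ u) {ε : ℝ} (hε : 0 < ε) :
    ∃ (κ : Type) (_ : Fintype κ) (w : κ → Y) (c : κ → Fin n → ℝ) (N : ℝ), 0 ≤ N ∧ (∀ k, 0 ≤ w k) ∧
      ∑ k, w k = u ∧ (∀ i, ∑ k, c k i • w k = y i) ∧
      ∀ k i, w k ≤ N • (ε • u - |y i - c k i • u|)⁺ := by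
  induction n with
  | zero => exact ⟨Unit, inferInstance, fun _ => u, fun _ => Fin.elim0, 0, le_rfl, fun _ => hu,
      by simp, fun i => i.elim0, fun _ i => i.elim0⟩
  | succ n ih =>
    obtain ⟨κ, _, a, c, N, hN, ha0, ha, hc, hac⟩ := ih (fun i => y i.succ) fun i => hy i.succ
    obtain ⟨m, b, d, N', hN', hb0, hb, hd, hbd⟩ := exists_hat_decomposition (hy 0) hε
    obtain ⟨w, hw0, hwa, hwb⟩ :=
      exists_common_refinement Finset.univ a b ha0 hb0 (ha.trans hb.symm)
    have hwa' : ∀ k, ∑ j, w k j = a k := fun k => hwa k (Finset.mem_univ k)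
    -- A refined piece lies below one piece of each partition, so it inherits the coefficients and
    -- the localization of both.
    refine ⟨κ × Fin m, inferInstance, fun k => w k.1 k.2, fun k => Fin.cons (d k.2) (c k.1),
      max N N', hN.trans (le_max_left _ _), fun k => hw0 _ _, ?_, fun i => ?_, fun k i => ?_⟩
    · rw [Fintype.sum_prod_type]
      simp [hwa', ha]
    · refine Fin.cases ?_ (fun i => ?_) i
      · rw [Fintype.sum_prod_type_right]
        simp [← Finset.smul_sum, hwb, hd]
      · rw [Fintype.sum_prod_type]
        simp [← Finset.smul_sum, hwa', hc]
    · refine Fin.cases ?_ (fun i => ?_) i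
      · refine le_trans ?_ ((hbd k.2).trans
          (smul_le_smul_of_nonneg_right (le_max_right _ _) (posPart_nonneg _)))
        rw [← hwb]
        exact Finset.single_le_sum (f := fun i => w i k.2) (fun i _ => hw0 i _) (Finset.mem_univ _)
      · refine le_trans ?_ ((hac k.1 i).trans
          (smul_le_smul_of_nonneg_right (le_max_left _ _) (posPart_nonneg _)))
        rw [← hwa']
        exact Finset.single_le_sum (f := fun i => w k.1 i) (fun i _ => hw0 _ i) (Finset.mem_univ _)

/-- Where `w` lives, every `y i` is within `ε • u` of `c i • u`, so `∑ a i • y i ≤ u` passes to the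
coefficients with error `n * ε`. If this failed, the functions under the hats would have a
nonpositive sum, and nothing positive could lie below all the hats. -/
theorem sum_mul_le_of_hat_ne_zero {n : ℕ} {u w : Y} (hu : 0 ≤ u) (hw0 : 0 ≤ w) (hw : w ≠ 0)
    (y : Fin n → Y) (a c : Fin n → ℝ) (ha : ∀ i, |a i| ≤ 1) (hy : ∑ i, a i • y i ≤ u) {ε N : ℝ}
    (hN : 0 ≤ N) (hwN : ∀ i, w ≤ N • (ε • u - |y i - c i • u|)⁺) :
    ∑ i, a i * c i ≤ 1 + n * ε := by
  by_contra! ht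
  rcases Nat.eq_zero_or_pos n with rfl | hn
  · simp at ht
    linarith
  have hNpos : 0 < N := by
    refine hN.lt_of_ne fun h => hw (le_antisymm ?_ hw0)
    simpa [← h] using hwN ⟨0, hn⟩
  have hsum : ∑ i, (ε • u - |y i - c i • u|) ≤ 0 := by
    have h1 : (∑ i, a i * c i) • u ≤ u + ∑ i, |y i - c i • u| := by
      have : (∑ i, a i * c i) • u = ∑ i, a i • y i + ∑ i, (-a i) • (y i - c i • u) := by
        rw [Finset.sum_smul, ← Finset.sum_add_distrib]
        refine Finset.sum_congr rfl fun i _ => ?_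
        rw [smul_sub, neg_smul, neg_smul, mul_smul]
        abel
      rw [this]
      refine add_le_add hy (Finset.sum_le_sum fun i _ => (smul_le_abs_smul_abs _ _).trans ?_)
      rw [abs_neg]
      simpa using smul_le_smul_of_nonneg_right (ha i) (abs_nonneg (y i - c i • u))
    have h2 := (smul_le_smul_of_nonneg_right ht.le hu).trans h1
    rw [add_smul, one_smul, add_le_add_iff_left] at h2
    rw [Finset.sum_sub_distrib, sub_nonpos]
    refine le_trans (le_of_eq ?_) h2
    rw [Finset.sum_const, Finset.card_univ, Fintype.card_fin, mul_smul, Nat.cast_smul_eq_nsmul]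
  have := nonpos_of_le_posPart_of_sum_nonpos hn _ hsum (N⁻¹ • w) fun i => by
    simpa [inv_smul_smul₀ hNpos.ne'] using
      smul_le_smul_of_nonneg_left (hwN i) (inv_nonneg.2 hN)
  have h3 := smul_le_smul_of_nonneg_left this hN
  rw [smul_zero, smul_inv_smul₀ hNpos.ne'] at h3
  exact hw (le_antisymm h3 hw0)

end HatDecomposition

/-! ### Duality between `lpSum p` on a Banach lattice and `lpSum q` on its dual. -/

section LpSumDuality

variable {Y : Type*} [NormedAddCommGroup Y] [Lattice Y] [HasSolidNorm Y] [IsOrderedAddMonoid Y]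
  [NormedSpace ℝ Y] [IsOrderedModule ℝ Y] [CompleteSpace Y]

theorem sum_smul_le_lpSum (p q : ℝ≥0∞) [hpq : p.HolderConjugate q] {n : ℕ} (y : Fin n → Y)
    {a : Fin n → ℝ} (ha : ‖WithLp.toLp q a‖ ≤ 1) : ∑ i, a i • y i ≤ lpSum p y := by
  obtain rfl := ENNReal.HolderConjugate.conjExponent_eq (p := p) (q := q)
  exact (isLUB_lpSum p y).1 ⟨WithLp.toLp _ a, ha, rfl⟩

theorem lpSum_le (p q : ℝ≥0∞) [hpq : p.HolderConjugate q] {n : ℕ} {y : Fin n → Y} {b : Y}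
    (h : ∀ a : Fin n → ℝ, ‖WithLp.toLp q a‖ ≤ 1 → ∑ i, a i • y i ≤ b) : lpSum p y ≤ b := by
  obtain rfl := ENNReal.HolderConjugate.conjExponent_eq (p := p) (q := q)
  refine (isLUB_lpSum p y).2 ?_
  rintro _ ⟨a, ha, rfl⟩
  exact h a.ofLp ha

theorem abs_apply_le_of_norm_toLp_le_one {q : ℝ≥0∞} [Fact (1 ≤ q)] {n : ℕ} {a : Fin n → ℝ}
    (ha : ‖WithLp.toLp q a‖ ≤ 1) (i : Fin n) : |a i| ≤ 1 :=
  (PiLp.norm_apply_le (WithLp.toLp q a) i).trans ha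

theorem abs_le_lpSum (p : ℝ≥0∞) [Fact (1 ≤ p)] {n : ℕ} (y : Fin n → Y) (i : Fin n) :
    |y i| ≤ lpSum p y := by
  have h : ∀ c : ℝ, |c| ≤ 1 → c • y i ≤ lpSum p y := fun c hc => by
    simpa [Pi.single_apply] using sum_smul_le_lpSum p p.conjExponent y (a := Pi.single i c)
      (by simpa using hc)
  refine abs_le'.2 ⟨by simpa using h 1 (by simp), by simpa using h (-1) (by simp)⟩

theorem lpSum_add_le (p : ℝ≥0∞) {n : ℕ} (x y : Fin n → Y) :
    lpSum p (x + y) ≤ lpSum p x + lpSum p y := by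
  refine (isLUB_lpSum p _).2 ?_
  rintro _ ⟨a, ha, rfl⟩
  simp only [Pi.add_apply, smul_add, Finset.sum_add_distrib]
  exact add_le_add ((isLUB_lpSum p x).1 ⟨a, ha, rfl⟩) ((isLUB_lpSum p y).1 ⟨a, ha, rfl⟩)

theorem lpSum_smul_le (p : ℝ≥0∞) {c : ℝ} (hc : 0 ≤ c) {n : ℕ} (x : Fin n → Y) :
    lpSum p (c • x) ≤ c • lpSum p x := by
  refine (isLUB_lpSum p _).2 ?_
  rintro _ ⟨a, ha, rfl⟩
  have h : ∑ i, a i • (c • x) i = c • ∑ i, a i • x i := by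
    rw [Finset.smul_sum]
    exact Finset.sum_congr rfl fun i _ => smul_comm _ _ _
  rw [h]
  exact smul_le_smul_of_nonneg_left ((isLUB_lpSum p x).1 ⟨a, ha, rfl⟩) hc

theorem lpSum_smul (p : ℝ≥0∞) {c : ℝ} (hc : 0 < c) {n : ℕ} (x : Fin n → Y) :
    lpSum p (c • x) = c • lpSum p x := by
  refine le_antisymm (lpSum_smul_le p hc.le x) ?_
  have := smul_le_smul_of_nonneg_left (lpSum_smul_le p (inv_nonneg.2 hc.le) (c • x)) hc.le
  rwa [inv_smul_smul₀ hc.ne', smul_inv_smul₀ hc.ne'] at this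

theorem lpSum_smul_const_le (p q : ℝ≥0∞) [hpq : p.HolderConjugate q] {n : ℕ} {b : Fin n → ℝ}
    (hb : ‖WithLp.toLp p b‖ ≤ 1) {z : Y} (hz : 0 ≤ z) : lpSum p (fun i => b i • z) ≤ z := by
  have : Fact (1 ≤ p) := ⟨ENNReal.HolderConjugate.one_le p q⟩
  have : Fact (1 ≤ q) := ⟨ENNReal.HolderConjugate.one_le q p⟩
  refine lpSum_le p q fun a ha => ?_
  have h : ∑ i, a i * b i ≤ 1 := by
    refine (Finset.sum_le_sum fun i _ => ?_).trans ((sum_norm_mul_norm_le_toLp p q b a).trans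
      (mul_le_one₀ hb (norm_nonneg (E := PiLp q fun _ : Fin n => ℝ) _) ha))
    rw [mul_comm, ← norm_mul]
    exact le_abs_self _
  simp only [smul_smul, ← Finset.sum_smul]
  simpa using smul_le_smul_of_nonneg_right h hz

/-- Hölder's inequality for functionals on a Banach lattice. -/
theorem sum_dual_apply_le_lpSum (p q : ℝ≥0∞) [hpq : p.HolderConjugate q] {n : ℕ}
    (y : Fin n → Y) (g : Fin n → StrongDual ℝ Y) :
    ∑ i, g i (y i) ≤ lpSum q g (lpSum p y) := by
  have : Fact (1 ≤ p) := ⟨ENNReal.HolderConjugate.one_le p q⟩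
  have : Fact (1 ≤ q) := ⟨ENNReal.HolderConjugate.one_le q p⟩
  set u := lpSum p y with hu
  have hu0 : 0 ≤ u := lpSum_nonneg p y
  have hF : 0 ≤ lpSum q g u := by simpa using lpSum_nonneg q g u hu0
  have key : ∀ ε : ℝ, 0 < ε → ∑ i, g i (y i) ≤ (1 + n * ε) * lpSum q g u := by
    intro ε hε
    obtain ⟨κ, _, w, c, N, hN, hw0, hw, hc, hwN⟩ :=
      exists_joint_hat_decomposition hu0 y (abs_le_lpSum p y) hε
    have hpos : 0 < 1 + n * ε := by positivity
    have hk : ∀ k, ∑ i, c k i * g i (w k) ≤ (1 + n * ε) * lpSum q g (w k) := by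
      intro k
      -- A zero piece carries no information about `c k`, but contributes nothing.
      rcases eq_or_ne (w k) 0 with h0 | h0
      · simp [h0]
      have hck : ‖WithLp.toLp p (c k)‖ ≤ 1 + n * ε := by
        obtain ⟨a, ha, hac⟩ := exists_sum_mul_eq_toLp p q (c k)
        rw [← hac]
        exact sum_mul_le_of_hat_ne_zero hu0 (hw0 k) h0 y a (c k)
          (abs_apply_le_of_norm_toLp_le_one ha) (sum_smul_le_lpSum p q y ha) hN (hwN k)
      -- The rescaled `c k` is admissible in the supremum defining `lpSum q g`; that inequality in
      -- the dual is evaluated at `w k ≥ 0`.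
      have hb : ‖WithLp.toLp p ((1 + n * ε)⁻¹ • c k)‖ ≤ 1 := by
        rw [WithLp.toLp_smul, norm_smul, norm_inv, Real.norm_of_nonneg hpos.le]
        exact inv_mul_le_one_of_le₀ hck hpos.le
      have := sum_smul_le_lpSum q p (hpq := hpq.symm) g hb (w k) (hw0 k)
      simp only [Pi.smul_apply, smul_apply, sum_apply, smul_eq_mul, mul_assoc,
        ← Finset.mul_sum] at this
      rwa [inv_mul_le_iff₀ hpos] at this
    calc ∑ i, g i (y i) = ∑ k, ∑ i, c k i * g i (w k) := by
          rw [Finset.sum_comm]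
          refine Finset.sum_congr rfl fun i _ => ?_
          rw [← hc i, map_sum]
          simp
      _ ≤ ∑ k, (1 + n * ε) * lpSum q g (w k) := Finset.sum_le_sum fun k _ => hk k
      _ = (1 + n * ε) * lpSum q g u := by rw [← Finset.mul_sum, ← map_sum, hw]
  refine le_of_forall_pos_le_add fun δ hδ => ?_
  -- This `ε` makes the excess `n * ε * lpSum q g u` at most `δ`; the `+ 1` keeps the denominator
  -- positive.
  refine (key (δ / (n * lpSum q g u + 1)) (by positivity)).trans ?_
  rw [add_mul, one_mul, add_le_add_iff_left, mul_div_assoc', div_mul_eq_mul_div,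
    div_le_iff₀ (by positivity)]
  nlinarith

/-- The map `z ↦ f (lpSum p z)` is sublinear because `f ≥ 0`. Hahn–Banach gives a linear `G` below
it with equality at `y`; the `g i` are the coordinates of `G`. -/
theorem exists_lpSum_dual_le (p q : ℝ≥0∞) [hpq : p.HolderConjugate q] {n : ℕ}
    (y : Fin n → Y) {f : StrongDual ℝ Y} (hf : 0 ≤ f) :
    ∃ g : Fin n → StrongDual ℝ Y, lpSum q g ≤ f ∧ ∑ i, g i (y i) = f (lpSum p y) := by
  have : Fact (1 ≤ p) := ⟨ENNReal.HolderConjugate.one_le p q⟩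
  have : Fact (1 ≤ q) := ⟨ENNReal.HolderConjugate.one_le q p⟩
  have hmono : ∀ {a b : Y}, a ≤ b → f a ≤ f b := fun {a b} hab => by
    simpa using hf (b - a) (sub_nonneg.2 hab)
  have hsub : ∀ x z : Fin n → Y, f (lpSum p (x + z)) ≤ f (lpSum p x) + f (lpSum p z) :=
    fun x z => (hmono (lpSum_add_le p x z)).trans_eq (map_add f _ _)
  have hhom : ∀ c : ℝ, 0 < c → ∀ x : Fin n → Y, f (lpSum p (c • x)) = c * f (lpSum p x) :=
    fun c hc x => by rw [lpSum_smul p hc, map_smul, smul_eq_mul]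
  have hpos : ∀ x : Fin n → Y, 0 ≤ f (lpSum p x) := fun x => by
    simpa using hmono (lpSum_nonneg p x)
  have hy : ∃ G : (Fin n → Y) →ₗ[ℝ] ℝ, G y = f (lpSum p y) ∧ ∀ z, G z ≤ f (lpSum p z) := by
    rcases eq_or_ne y 0 with rfl | hy0
    · refine ⟨0, ?_, fun z => by simpa using hpos z⟩
      have := hhom 2 two_pos 0
      rw [smul_zero] at this
      rw [LinearMap.zero_apply]
      linarith
    · obtain ⟨G, hG, hGle⟩ := exists_extension_of_le_sublinear
        (LinearPMap.mkSpanSingleton y (f (lpSum p y)) hy0) (fun z => f (lpSum p z)) hhom hsub (by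
          rintro ⟨z, hz⟩
          obtain ⟨c, rfl⟩ := Submodule.mem_span_singleton.1 hz
          refine (LinearPMap.mkSpanSingleton'_apply y (f (lpSum p y)) _ c hz).trans_le ?_
          rw [smul_eq_mul]
          rcases lt_or_ge 0 c with hc | hc
          · exact (hhom c hc y).ge
          -- For `c ≤ 0` domination is a matter of sign, since `f ∘ lpSum p` is nonnegative.
          · exact (mul_nonpos_of_nonpos_of_nonneg hc (hpos y)).trans (hpos _))
      refine ⟨G, ?_, hGle⟩
      exact (hG ⟨y, Submodule.mem_span_singleton_self y⟩).trans
        (LinearPMap.mkSpanSingleton'_apply_self _ _ _ _)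
  obtain ⟨G, hG, hGle⟩ := hy
  have hGsum : ∀ z : Fin n → Y, ∑ i, G (Pi.single i (z i)) = G z := fun z => by
    rw [← map_sum, Finset.univ_sum_single]
  -- Continuity of the coordinates: the `lpSum` of a family with one nonzero entry `z` is at most
  -- `|z|`.
  have hbound : ∀ i z, ‖(G ∘ₗ LinearMap.single ℝ (fun _ => Y) i) z‖ ≤ ‖f‖ * ‖z‖ := by
    intro i z
    have h1 : ∀ z : Y, G (Pi.single i z) ≤ ‖f‖ * ‖z‖ := by
      intro z
      refine (hGle _).trans ((hmono (lpSum_le p q (b := |z|) fun a ha => ?_)).trans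
        ((le_abs_self _).trans ((f.le_opNorm _).trans_eq (by rw [norm_abs_eq_norm]))))
      have : ∑ j, a j • (Pi.single i z : Fin n → Y) j = a i • z := by
        rw [Finset.sum_eq_single i] <;> simp +contextual
      rw [this]
      refine (smul_le_abs_smul_abs _ _).trans ?_
      simpa using smul_le_smul_of_nonneg_right (abs_apply_le_of_norm_toLp_le_one ha i)
        (abs_nonneg z)
    refine abs_le'.2 ⟨h1 z, ?_⟩
    simpa [Pi.single_neg] using h1 (-z)
  refine ⟨fun i => (G ∘ₗ LinearMap.single ℝ (fun _ => Y) i).mkContinuous ‖f‖ (hbound i),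
    lpSum_le q p (hpq := hpq.symm) fun b hb z hz => ?_, ?_⟩
  -- Here `∑ b i • g i` at `z ≥ 0` is `G` at the family `b i • z`, whose `lpSum p` is at most `z`
  -- when `b` is in the unit ball of `ℓ_p`.
  · refine le_trans (le_of_eq ?_)
      ((hGle fun i => b i • z).trans (hmono (lpSum_smul_const_le p q hb hz)))
    rw [← hGsum]
    simp [Pi.single_smul]
  · rw [← hG, ← hGsum]
    rfl

/-- A functional norming `lpSum p y` may be replaced by its modulus, as `lpSum p y ≥ 0`; the
previous lemma then splits it. -/
theorem exists_norm_lpSum_le_sum_dual_apply (p q : ℝ≥0∞) [hpq : p.HolderConjugate q] {n : ℕ}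
    (y : Fin n → Y) : ∃ g : Fin n → StrongDual ℝ Y, ‖lpSum q g‖ ≤ 1 ∧
      ‖lpSum p y‖ ≤ ∑ i, g i (y i) := by
  obtain ⟨f, hf, hfu⟩ := exists_dual_vector'' ℝ (lpSum p y)
  obtain ⟨g, hg, hgy⟩ := exists_lpSum_dual_le p q y (abs_nonneg f)
  refine ⟨g, ?_, ?_⟩
  · refine le_trans (norm_le_norm_of_abs_le_abs ?_) hf
    rwa [abs_of_nonneg (lpSum_nonneg q g)]
  · rw [hgy]
    exact hfu.ge.trans (le_abs_self f _ (lpSum_nonneg p y))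

end LpSumDuality

/-! ### Sum hulls and trace duality. -/

theorem le_mul_csInf {S : Set ℝ} (hS : S.Nonempty) {a C : ℝ} (hC : 0 ≤ C)
    (h : ∀ r ∈ S, a ≤ C * r) : a ≤ C * sInf S := by
  rcases hC.eq_or_lt with rfl | hC
  · obtain ⟨r, hr⟩ := hS
    simpa using h r hr
  · rw [← div_le_iff₀' hC]
    exact le_csInf hS fun r hr => (div_le_iff₀' hC).2 (h r hr)

section SumHull

variable {E : Type*} [AddCommGroup E] [Module ℝ E] {φ : E → ℝ} (h0 : ∀ z, 0 ≤ φ z)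
  (hs : ∀ (c : ℝ) (z : E), φ (c • z) ≤ |c| * φ z)

theorem sumHullSeminorm_le (z : E) : sumHullSeminorm φ h0 hs z ≤ φ z := by
  refine csInf_le ⟨0, ?_⟩ ⟨1, fun _ => z, by simp, by simp⟩
  rintro _ ⟨m, w, -, rfl⟩
  exact Finset.sum_nonneg fun j _ => h0 _

/-- Additivity of `F` passes the bound to every decomposition, so forcing the triangle inequality on
`φ` costs nothing for linear functionals. -/
theorem le_mul_sumHullSeminorm (F : E →ₗ[ℝ] ℝ) {C : ℝ} (hC : 0 ≤ C) (hF : ∀ z, F z ≤ C * φ z)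
    (z : E) : F z ≤ C * sumHullSeminorm φ h0 hs z := by
  change F z ≤ C * sInf _
  refine le_mul_csInf ?_ hC ?_
  · exact ⟨φ z, 1, fun _ => z, by simp, by simp⟩
  rintro _ ⟨m, w, rfl, rfl⟩
  rw [map_sum, Finset.mul_sum]
  exact Finset.sum_le_sum fun j _ => hF (w j)

end SumHull

section TraceDuality

variable {X Y : Type*} [NormedAddCommGroup X] [NormedSpace ℝ X] [NormedAddCommGroup Y]
  [NormedSpace ℝ Y]

/-- The functional `x ⊗ y' ↦ y' (T x)` on `X ⊗ Y*`. -/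
noncomputable def tracePairing (T : X →ₗ[ℝ] Y) : X ⊗[ℝ] StrongDual ℝ Y →ₗ[ℝ] ℝ :=
  TensorProduct.lift (LinearMap.mk₂ ℝ (fun x (y' : StrongDual ℝ Y) => y' (T x))
    (fun _ _ _ => by simp) (fun _ _ _ => by simp) (fun _ _ _ => by simp) (fun _ _ _ => by simp))

@[simp]
theorem tracePairing_tmul (T : X →ₗ[ℝ] Y) (x : X) (y' : StrongDual ℝ Y) :
    tracePairing T (x ⊗ₜ[ℝ] y') = y' (T x) := by
  simp [tracePairing]

theorem tracePairing_add (S T : X →ₗ[ℝ] Y) :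
    tracePairing (S + T) = tracePairing S + tracePairing T :=
  TensorProduct.ext' fun x y' => by simp

theorem tracePairing_smul (c : ℝ) (T : X →ₗ[ℝ] Y) :
    tracePairing (c • T) = c • tracePairing T :=
  TensorProduct.ext' fun x y' => by simp

/-- If `P C T` means that the trace functional of `T` is bounded by `C` on `X ⊗_s Y*`, then the
operators with `P C T` for some `C` form the space `(X ⊗_s Y*)* ∩ ℒ(X, Y)`. -/
theorem exists_equiv_dualInterOperators (s : Seminorm ℝ (X ⊗[ℝ] StrongDual ℝ Y))
    (V : Submodule ℝ (X →ₗ[ℝ] Y)) (P : ℝ → (X →ₗ[ℝ] Y) → Prop)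
    (hV : ∀ T, T ∈ V ↔ ∃ C : ℝ, 0 ≤ C ∧ P C T)
    (hbound : ∀ T C, 0 ≤ C → P C T → ∀ x, ‖T x‖ ≤ C * ‖x‖)
    (hP : ∀ T C, 0 ≤ C → (P C T ↔ ∀ z, tracePairing T z ≤ C * s z)) :
    ∃ e : V ≃ₗ[ℝ] dualInterOperators s,
      (∀ (T : V) (x : X) (y' : StrongDual ℝ Y),
        (e T : StrongDual ℝ (SeminormedBy s)) (SeminormedBy.of s (x ⊗ₜ[ℝ] y')) =
          y' ((T : X →ₗ[ℝ] Y) x)) ∧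
      ∀ T : V, ‖e T‖ = sInf {C : ℝ | 0 ≤ C ∧ P C T} := by
  have habs : ∀ (T : X →ₗ[ℝ] Y) C, 0 ≤ C → P C T → ∀ z, ‖tracePairing T z‖ ≤ C * s z := by
    intro T C hC hT z
    refine abs_le'.2 ⟨(hP T C hC).1 hT z, ?_⟩
    simpa using (hP T C hC).1 hT (-z)
  have hex : ∀ T : V, ∃ C : ℝ, ∀ z : SeminormedBy s,
      ‖(tracePairing (T : X →ₗ[ℝ] Y) ∘ₗ (SeminormedBy.of s).symm.toLinearMap) z‖ ≤ C * ‖z‖ := by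
    intro T
    obtain ⟨C, hC, hT⟩ := (hV T).1 T.2
    exact ⟨C, fun z => habs T C hC hT ((SeminormedBy.of s).symm z)⟩
  let φ : V → StrongDual ℝ (SeminormedBy s) := fun T =>
    (tracePairing (T : X →ₗ[ℝ] Y) ∘ₗ
      (SeminormedBy.of s).symm.toLinearMap).mkContinuousOfExistsBound (hex T)
  have hφ : ∀ T z, φ T (SeminormedBy.of s z) = tracePairing (T : X →ₗ[ℝ] Y) z := fun _ _ => rfl
  have hmem : ∀ T, φ T ∈ dualInterOperators s := by
    intro T
    obtain ⟨C, hC, hT⟩ := (hV T).1 T.2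
    exact ⟨(T : X →ₗ[ℝ] Y).mkContinuous C (hbound T C hC hT), fun x y' => by simp [hφ]⟩
  have hadd : ∀ S T, φ (S + T) = φ S + φ T := fun S T => ContinuousLinearMap.ext fun z => by
    obtain ⟨z, rfl⟩ := (SeminormedBy.of s).surjective z
    rw [add_apply, hφ, hφ, hφ, Submodule.coe_add, tracePairing_add, LinearMap.add_apply]
  have hsmul : ∀ (c : ℝ) T, φ (c • T) = c • φ T := fun c T => ContinuousLinearMap.ext fun z => by
    obtain ⟨z, rfl⟩ := (SeminormedBy.of s).surjective z
    rw [smul_apply, hφ, hφ, Submodule.coe_smul, tracePairing_smul, LinearMap.smul_apply]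
  let ψ : V →ₗ[ℝ] dualInterOperators s :=
    { toFun := fun T => ⟨φ T, hmem T⟩
      map_add' := fun S T => Subtype.ext (hadd S T)
      map_smul' := fun c T => Subtype.ext (hsmul c T) }
  have hψ : ∀ (T : V) x (y' : StrongDual ℝ Y),
      (ψ T : StrongDual ℝ (SeminormedBy s)) (SeminormedBy.of s (x ⊗ₜ[ℝ] y')) =
        y' ((T : X →ₗ[ℝ] Y) x) := fun T x y' => (hφ T _).trans (tracePairing_tmul _ _ _)
  -- The norm of the functional is itself an admissible constant. This gives surjectivity and shows
  -- that the infimum is attained.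
  have hle : ∀ (f : StrongDual ℝ (SeminormedBy s)) (T : X →ₗ[ℝ] Y),
      (∀ z, f (SeminormedBy.of s z) = tracePairing T z) → P ‖f‖ T := fun f T hf =>
    (hP T ‖f‖ (norm_nonneg f)).2 fun z => by
      rw [← hf]
      exact (le_abs_self _).trans (f.le_opNorm _)
  have hinj : Function.Injective ψ := fun S T hST => by
    refine Subtype.ext (LinearMap.ext fun x => ?_)
    -- `Y*` separates the points of `Y`, so the functional determines the operator.
    refine (SeparatingDual.eq_iff_forall_dual_eq (R := ℝ)).2 fun y' => ?_
    rw [← hψ, ← hψ, hST]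
  have hsurj : Function.Surjective ψ := by
    rintro ⟨f, T, hT⟩
    have hfT : ∀ z, f (SeminormedBy.of s z) = tracePairing (T : X →ₗ[ℝ] Y) z := by
      intro z
      have : f.toLinearMap ∘ₗ (SeminormedBy.of s).toLinearMap = tracePairing (T : X →ₗ[ℝ] Y) :=
        TensorProduct.ext' fun x y' => by simpa using! hT x y'
      exact LinearMap.congr_fun this z
    refine ⟨⟨T, (hV _).2 ⟨‖f‖, norm_nonneg f, hle f T hfT⟩⟩, ?_⟩
    exact Subtype.ext (ContinuousLinearMap.ext fun z => (hfT _).symm)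
  refine ⟨LinearEquiv.ofBijective ψ ⟨hinj, hsurj⟩, hψ, fun T => ?_⟩
  apply le_antisymm
  · refine le_csInf ((hV T).1 T.2) ?_
    rintro C ⟨hC, hT⟩
    exact (φ T).opNorm_le_bound hC fun z => habs T C hC hT _
  · exact csInf_le ⟨0, fun C hC => hC.1⟩ ⟨norm_nonneg (φ T), hle (φ T) T (hφ T)⟩

end TraceDuality

/-! ### Convex operators. -/

section Convex

variable {X Y : Type*} [NormedAddCommGroup X] [NormedSpace ℝ X]
  [NormedAddCommGroup Y] [Lattice Y] [HasSolidNorm Y] [IsOrderedAddMonoid Y]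
  [NormedSpace ℝ Y] [IsOrderedModule ℝ Y] [CompleteSpace Y]

theorem tensorDelta_le {Z : Type*} [NormedAddCommGroup Z] [Lattice Z] [HasSolidNorm Z]
    [IsOrderedAddMonoid Z] [NormedSpace ℝ Z] [IsOrderedModule ℝ Z] [CompleteSpace Z] (p q : ℝ≥0∞)
    [Fact (1 ≤ q)] {n : ℕ} (x : Fin n → X) (y : Fin n → Z) :
    tensorDelta p q (∑ i, x i ⊗ₜ[ℝ] y i) ≤ ‖WithLp.toLp q x‖ * ‖lpSum p.conjExponent y‖ := by
  refine csInf_le ⟨0, ?_⟩ ⟨n, x, y, rfl, rfl⟩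
  rintro _ ⟨n, x, y, -, rfl⟩
  positivity

/-- Families of length one suffice. This supplies the bounded operator required for membership in
`ℒ(X, Y)`. -/
theorem IsPQConvexWith.norm_apply_le {p q : ℝ≥0∞} [Fact (1 ≤ p)] [Fact (1 ≤ q)] {C : ℝ}
    {T : X →ₗ[ℝ] Y} (hT : IsPQConvexWith p q C T) (x : X) : ‖T x‖ ≤ C * ‖x‖ := by
  have h1 := hT 1 (Pi.single 0 x)
  have h2 : ‖WithLp.toLp q (Pi.single 0 x : Fin 1 → X)‖ = ‖x‖ := by simp
  rw [h2] at h1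
  refine le_trans (norm_le_norm_of_abs_le_abs ?_) h1
  rw [abs_of_nonneg (lpSum_nonneg p _)]
  simpa using abs_le_lpSum p (fun i => T ((Pi.single 0 x : Fin 1 → X) i)) 0

/-- Lattice Hölder bounds the trace functional on each representation of a tensor. Conversely, the
bound is tested on `∑ x i ⊗ g i` with `g` norming the family `T (x i)`. -/
theorem isPQConvexWith_iff {p q : ℝ≥0∞} [Fact (1 ≤ p)] [Fact (1 ≤ q)] {C : ℝ} (hC : 0 ≤ C)
    (T : X →ₗ[ℝ] Y) : IsPQConvexWith p q C T ↔
      ∀ z, tracePairing T z ≤ C * tensorH X (StrongDual ℝ Y) p q z := by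
  constructor
  · refine fun hT => le_mul_sumHullSeminorm _ _ _ hC fun z => ?_
    obtain ⟨n, x, y, hz⟩ := exists_tensor_eq_sum z
    change tracePairing T z ≤ C * sInf _
    refine le_mul_csInf ?_ hC ?_
    · exact ⟨_, n, x, y, hz, rfl⟩
    rintro _ ⟨n, x, y, rfl, rfl⟩
    simp only [map_sum, tracePairing_tmul]
    calc ∑ i, y i (T (x i))
        ≤ lpSum p.conjExponent y (lpSum p fun i => T (x i)) :=
          sum_dual_apply_le_lpSum p p.conjExponent (fun i => T (x i)) y
      _ ≤ ‖lpSum p.conjExponent y‖ * ‖lpSum p fun i => T (x i)‖ :=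
          (le_abs_self _).trans ((lpSum p.conjExponent y).le_opNorm (lpSum p fun i => T (x i)))
      _ ≤ ‖lpSum p.conjExponent y‖ * (C * ‖WithLp.toLp q x‖) :=
          mul_le_mul_of_nonneg_left (hT n x) (norm_nonneg _)
      _ = C * (‖WithLp.toLp q x‖ * ‖lpSum p.conjExponent y‖) := by ring
  · intro h n x
    obtain ⟨g, hg, hgx⟩ :=
      exists_norm_lpSum_le_sum_dual_apply p p.conjExponent fun i => T (x i)
    calc ‖lpSum p fun i => T (x i)‖ ≤ tracePairing T (∑ i, x i ⊗ₜ[ℝ] g i) := by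
          simpa using hgx
      _ ≤ C * (‖WithLp.toLp q x‖ * ‖lpSum p.conjExponent g‖) := (h _).trans
          (mul_le_mul_of_nonneg_left
            ((sumHullSeminorm_le _ _ _).trans (tensorDelta_le p q x g)) hC)
      _ ≤ C * ‖WithLp.toLp q x‖ := mul_le_mul_of_nonneg_left
          (mul_le_of_le_one_right (norm_nonneg (WithLp.toLp q x)) hg) hC

end Convex

/-! ### Concave operators. -/

section Concave

variable {X Y : Type*} [NormedAddCommGroup X] [Lattice X] [HasSolidNorm X]
  [IsOrderedAddMonoid X] [NormedSpace ℝ X] [IsOrderedModule ℝ X] [CompleteSpace X]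
  [NormedAddCommGroup Y] [NormedSpace ℝ Y]

theorem tensorIota_le {Z : Type*} [NormedAddCommGroup Z] [NormedSpace ℝ Z] (p q : ℝ≥0∞) {n : ℕ}
    (x : Fin n → X) (z : Fin n → Z) :
    tensorIota p q (∑ i, x i ⊗ₜ[ℝ] z i) ≤ ‖lpSum q x‖ * ‖WithLp.toLp p.conjExponent z‖ := by
  refine csInf_le ⟨0, ?_⟩ ⟨n, x, z, rfl, rfl⟩
  rintro _ ⟨n, x, z, -, rfl⟩
  positivity

theorem IsPQConcaveWith.norm_apply_le {p q : ℝ≥0∞} [Fact (1 ≤ p)] [Fact (1 ≤ q)] {C : ℝ}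
    (hC : 0 ≤ C) {T : X →ₗ[ℝ] Y} (hT : IsPQConcaveWith p q C T) (x : X) : ‖T x‖ ≤ C * ‖x‖ := by
  have h1 : ‖lpSum q fun _ : Fin 1 => x‖ ≤ ‖x‖ := by
    refine norm_le_norm_of_abs_le_abs ?_
    rw [abs_of_nonneg (lpSum_nonneg q _)]
    refine lpSum_le q q.conjExponent fun a ha => ?_
    rw [Fin.sum_univ_one]
    refine (smul_le_abs_smul_abs _ _).trans ?_
    simpa using smul_le_smul_of_nonneg_right (abs_apply_le_of_norm_toLp_le_one ha 0)
      (abs_nonneg x)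
  exact (PiLp.norm_apply_le (WithLp.toLp p fun _ : Fin 1 => T x) 0).trans
    ((hT 1 fun _ => x).trans (mul_le_mul_of_nonneg_left h1 hC))

/-- The factor `‖lpSum q x‖` occurs unchanged in the inequality and in `ι`, so only the norm duality
of `ℓ_p(Y)` and `ℓ_{p'}(Y*)` is needed. -/
theorem isPQConcaveWith_iff {p q : ℝ≥0∞} [Fact (1 ≤ p)] {C : ℝ} (hC : 0 ≤ C)
    (T : X →ₗ[ℝ] Y) : IsPQConcaveWith p q C T ↔
      ∀ z, tracePairing T z ≤ C * tensorK X (StrongDual ℝ Y) p q z := by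
  constructor
  · refine fun hT => le_mul_sumHullSeminorm _ _ _ hC fun z => ?_
    obtain ⟨n, x, y, hz⟩ := exists_tensor_eq_sum z
    change tracePairing T z ≤ C * sInf _
    refine le_mul_csInf ?_ hC ?_
    · exact ⟨_, n, x, y, hz, rfl⟩
    rintro _ ⟨n, x, y, rfl, rfl⟩
    simp only [map_sum, tracePairing_tmul, ← mul_assoc]
    exact (sum_dual_apply_le_toLp p p.conjExponent (fun i => T (x i)) y).trans
      (mul_le_mul_of_nonneg_right (hT n x) (norm_nonneg _))
  · intro h n x
    obtain ⟨g, hg, hgx⟩ := exists_sum_dual_apply_eq_toLp p p.conjExponent fun i => T (x i)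
    calc ‖WithLp.toLp p fun i => T (x i)‖ = tracePairing T (∑ i, x i ⊗ₜ[ℝ] g i) := by
          simpa using hgx.symm
      _ ≤ C * (‖lpSum q x‖ * ‖WithLp.toLp p.conjExponent g‖) := (h _).trans
          (mul_le_mul_of_nonneg_left
            ((sumHullSeminorm_le _ _ _).trans (tensorIota_le p q x g)) hC)
      _ ≤ C * ‖lpSum q x‖ := mul_le_mul_of_nonneg_left
          (mul_le_of_le_one_right (norm_nonneg _) hg) hC

end Concave

theorem mainTheorem10 (p q : ℝ≥0∞) [Fact (1 ≤ p)] [Fact (1 ≤ q)] (hqp : q ≤ p)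
    {E : Type*} [NormedAddCommGroup E] [NormedSpace ℝ E] [CompleteSpace E]
    {L : Type*} [NormedAddCommGroup L] [Lattice L] [HasSolidNorm L] [IsOrderedAddMonoid L]
    [NormedSpace ℝ L] [IsOrderedModule ℝ L] [CompleteSpace L] :
    (∃ e : PQConvex p q E L ≃ₗ[ℝ] dualInterOperators (tensorH E (StrongDual ℝ L) p q),
      (∀ (T : PQConvex p q E L) (x : E) (y' : StrongDual ℝ L),
        (e T : StrongDual ℝ (SeminormedBy (tensorH E (StrongDual ℝ L) p q)))
          (SeminormedBy.of _ (x ⊗ₜ[ℝ] y')) = y' ((T : E →ₗ[ℝ] L) x)) ∧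
      ∀ T : PQConvex p q E L, ‖e T‖ = pqConvexConst p q (T : E →ₗ[ℝ] L)) ∧
    (∃ e : PQConcave p q L E ≃ₗ[ℝ] dualInterOperators (tensorK L (StrongDual ℝ E) p q),
      (∀ (T : PQConcave p q L E) (x : L) (y' : StrongDual ℝ E),
        (e T : StrongDual ℝ (SeminormedBy (tensorK L (StrongDual ℝ E) p q)))
          (SeminormedBy.of _ (x ⊗ₜ[ℝ] y')) = y' ((T : L →ₗ[ℝ] E) x)) ∧
      ∀ T : PQConcave p q L E, ‖e T‖ = pqConcaveConst p q (T : L →ₗ[ℝ] E)) := by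
  exact ⟨exists_equiv_dualInterOperators _ _ (IsPQConvexWith p q) (fun _ => Iff.rfl)
      (fun _ _ _ hT => hT.norm_apply_le) fun T _ hC => isPQConvexWith_iff hC T,
    exists_equiv_dualInterOperators _ _ (IsPQConcaveWith p q) (fun _ => Iff.rfl)
      (fun _ _ hC hT => hT.norm_apply_le hC) fun T _ hC => isPQConcaveWith_iff hC T⟩
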